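/- Let $X$ be a real Banach space with dual $X^*$, and let $\varphi\colon X\to(-\infty,\infty]$ be a lower semicontinuous (l.s.c.) function. For $f\colon X\to(-\infty,\infty]$ and $x$ with $f(x)<\infty$, the $\varepsilon$-regular subdifferential ($\varepsilon\ge 0$) is $$\widehat\partial_\varepsilon f(x)=\Big\{x^*\in X^*\;\Big|\;\liminf_{y\to x,\,y\ne x}\frac{f(y)-f(x)-\langle x^*,y-x\rangle}{\|y-x\|}\ge-\varepsilon\Big\},$$ and the limiting subdifferential $\partial f(x)$ is the set of all $x^*\in X^*$ for which there are sequences $\varepsilon_k\downarrow 0$, $x_k\to x$ with $f(x_k)\to f(x)$, and $x_k^*\in\widehat\partial_{\varepsilon_k}f(x_k)$ with $x_k^*\to x^*$ in the weak$^*$ topology; both sets are empty if $f(x)=\infty$. Put $\operatorname{gph}\partial f=\{(x,x^*)\mid x^*\in\partial f(x)\}$ and let $J(x)=\{x^*\in X^*\mid\langle x^*,x\rangle=\|x\|^2=\|x^*\|^2\}$ be the duality mapping. For $\sigma>0$, $f$ is called $\sigma$-strongly convex if $f-\frac{\sigma}{2}\|\cdot\|^2$ is convex. Neighborhoods are open.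 Let $\bar x^*\in\partial\varphi(\bar x)$ and $\sigma\ge 0$, and consider the following statements. **(i)** $\varphi$ is variationally $\sigma$-convex at $\bar x$ for $\bar x^*$: there exist a convex neighborhood $U\times V$ of $(\bar x,\bar x^*)$, a number $\varepsilon>0$, and a convex l.s.c. function $\widehat\varphi\colon X\to(-\infty,\infty]$, which is $\sigma$-strongly convex if $\sigma>0$, such that $\widehat\varphi\le\varphi$ on $U$, $$(U_\varepsilon\times V)\cap\operatorname{gph}\partial\varphi=(U\times V)\cap\operatorname{gph}\partial\widehat\varphi,$$ and $\varphi(x)=\widehat\varphi(x)$ for all $(x,x^*)$ in this common set, where $U_\varepsilon:=\{x\in U\mid\varphi(x)<\varphi(\bar x)+\varepsilon\}$. **(ii)** There exist a convex neighborhood $U\times V$ of $(\bar x,\bar x^*)$ and a number $\varepsilon>0$ such that for every $(u,u^*)\in(U_\varepsilon\times V)\cap\operatorname{gph}\partial\varphi$, with $U_\varepsilon$ as above, there exists $j(u)\in J(u)$ for which $$\varphi(x)\ge\varphi(u)+\langle u^*,x-u\rangle+\frac{\sigma}{2}\big(\|u\|^2-2\langle j(u),x\rangle+\|x\|^2\big)\quad\text{for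 all }x\in U.$$ Then (i) implies (ii). Conversely, (ii) implies (i) if $X$ is reflexive and $\varphi$ is weakly sequentially l.s.c. around $\bar x$, i.e., there is a neighborhood $W$ of $\bar x$ such that for every $x\in W$ and every sequence $(x_k)$ in $X$ converging weakly to $x$, $\liminf_{k\to\infty}\varphi(x_k)\ge\varphi(x)$. -/

import Mathlib

open Filter Topology

namespace VarConvex

variable {X : Type*} [NormedAddCommGroup X] [NormedSpace ℝ X]

/-- `f` takes values in `(-∞, ∞]`. -/
def NeverBot (f : X → EReal) : Prop :=
  ∀ x, f x ≠ ⊥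

/-- The `ε`-regular subdifferential of `f` at `x` (empty when `f x = ∞`). The lower limit is taken
over points different from `x`. -/
noncomputable def epsRegularSubdiff (ε : ℝ) (f : X → EReal) (x : X) : Set (StrongDual ℝ X) :=
  {xs | f x ≠ ⊤ ∧
    ((-ε : ℝ) : EReal) ≤
      liminf (fun y : X => (f y - f x - ((xs (y - x) : ℝ) : EReal)) / ((‖y - x‖ : ℝ) : EReal))
        (𝓝[≠] x)}

/-- The limiting (Mordukhovich) subdifferential of `f` at `x` (empty when `f x = ∞`): all weak-star
limits of sequences of `ε k`-regular subgradients at `xk k`, where `ε k ↓ 0`, `xk k → x`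
and `f (xk k) → f x`. -/
def limitingSubdiff (f : X → EReal) (x : X) : Set (StrongDual ℝ X) :=
  {xs | f x ≠ ⊤ ∧
    ∃ (ε : ℕ → ℝ) (xk : ℕ → X) (xsk : ℕ → StrongDual ℝ X),
      (∀ k, 0 < ε k) ∧ Tendsto ε atTop (𝓝 0) ∧
      Tendsto xk atTop (𝓝 x) ∧ Tendsto (fun k => f (xk k)) atTop (𝓝 (f x)) ∧
      (∀ v : X, Tendsto (fun k => xsk k v) atTop (𝓝 (xs v))) ∧
      ∀ k, xsk k ∈ epsRegularSubdiff (ε k) f (xk k)}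

/-- The graph of the limiting subgradient mapping. -/
def gphSubdiff (f : X → EReal) : Set (X × StrongDual ℝ X) :=
  {p | p.2 ∈ limitingSubdiff f p.1}

/-- The duality mapping `J(x) = {x* | ⟨x*, x⟩ = ‖x‖² = ‖x*‖²}`. -/
def dualityMap (x : X) : Set (StrongDual ℝ X) :=
  {xs | xs x = ‖x‖ ^ 2 ∧ ‖x‖ ^ 2 = ‖xs‖ ^ 2}

/-- Convexity of an extended-real-valued function (used for functions with values in `(-∞, ∞]`). -/
def IsConvex (f : X → EReal) : Prop :=
  ∀ x y : X, ∀ a b : ℝ, 0 < a → 0 < b → a + b = 1 →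
    f (a • x + b • y) ≤ (a : EReal) * f x + (b : EReal) * f y

/-- `σ`-strong convexity: the quadratic shift `f - (σ/2)‖·‖²` is convex. -/
def IsStronglyConvex (σ : ℝ) (f : X → EReal) : Prop :=
  IsConvex fun x => f x - ((σ / 2 * ‖x‖ ^ 2 : ℝ) : EReal)

/-- The `f`-attentive part `U_ε = {x ∈ U | f x < f x₀ + ε}` of `U`. -/
def attentive (f : X → EReal) (x₀ : X) (U : Set X) (ε : ℝ) : Set X :=
  {x ∈ U | f x < f x₀ + (ε : EReal)}

/-- `U × V` is a convex (open) neighborhood of `(x₀, xs₀)`. -/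
def IsConvexNhd (U : Set X) (V : Set (StrongDual ℝ X)) (x₀ : X) (xs₀ : StrongDual ℝ X) : Prop :=
  IsOpen U ∧ Convex ℝ U ∧ x₀ ∈ U ∧ IsOpen V ∧ Convex ℝ V ∧ xs₀ ∈ V

/-- Variational `σ`-convexity of `f` at `x₀` for the limiting subgradient `xs₀`: variational
convexity when `σ = 0`, and `σ`-strong variational convexity when `σ > 0`. -/
def IsVariationallyConvex (σ : ℝ) (f : X → EReal) (x₀ : X) (xs₀ : StrongDual ℝ X) : Prop :=
  xs₀ ∈ limitingSubdiff f x₀ ∧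
  ∃ (U : Set X) (V : Set (StrongDual ℝ X)) (g : X → EReal) (ε : ℝ),
    IsConvexNhd U V x₀ xs₀ ∧ 0 < ε ∧
    NeverBot g ∧ LowerSemicontinuous g ∧ IsConvex g ∧ (0 < σ → IsStronglyConvex σ g) ∧
    (∀ x ∈ U, g x ≤ f x) ∧
    (attentive f x₀ U ε ×ˢ V) ∩ gphSubdiff f = (U ×ˢ V) ∩ gphSubdiff g ∧
    ∀ p ∈ (U ×ˢ V) ∩ gphSubdiff g, f p.1 = g p.1

/-- The description of the subdifferential graph of `f` near `(x₀, xs₀)` through uniform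
quadratic subgradient inequalities on a neighborhood. -/
def HasSubgradientInequalities (σ : ℝ) (f : X → EReal) (x₀ : X) (xs₀ : StrongDual ℝ X) : Prop :=
  ∃ (U : Set X) (V : Set (StrongDual ℝ X)) (ε : ℝ),
    IsConvexNhd U V x₀ xs₀ ∧ 0 < ε ∧
    ∀ (u : X) (us : StrongDual ℝ X),
      (u, us) ∈ (attentive f x₀ U ε ×ˢ V) ∩ gphSubdiff f →
      ∃ j ∈ dualityMap u, ∀ x ∈ U,
        f u + ((us (x - u) + σ / 2 * (‖u‖ ^ 2 - 2 * j x + ‖x‖ ^ 2) : ℝ) : EReal) ≤ f x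

/-- Weak sequential lower semicontinuity of `f` at `x`. -/
def WeakSeqLSCAt (f : X → EReal) (x : X) : Prop :=
  ∀ xk : ℕ → X, (∀ l : StrongDual ℝ X, Tendsto (fun k => l (xk k)) atTop (𝓝 (l x))) →
    f x ≤ liminf (fun k => f (xk k)) atTop

/-- Weak sequential lower semicontinuity of `f` around `x₀`, i.e. at all points near `x₀`. -/
def WeakSeqLSCAround (f : X → EReal) (x₀ : X) : Prop :=
  ∀ᶠ x in 𝓝 x₀, WeakSeqLSCAt f x

/-- Reflexivity: the canonical embedding into the (topological) bidual is onto. -/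
def IsReflexiveSpace (X : Type*) [NormedAddCommGroup X] [NormedSpace ℝ X] : Prop :=
  Function.Surjective (NormedSpace.inclusionInDoubleDual ℝ X)

end VarConvex

/-! For (i) ⇒ (ii), limiting subgradients of the convex minorant are global subgradients in the
sense of convex analysis. When `σ > 0`, the minorant is a convex function plus `σ / 2 * ‖·‖ ^ 2`.
Separating two convex sets splits the subgradient along this sum, and the quadratic part of it is
`σ` times an element of the duality mapping (`IsStronglyConvex.exists_dualityMap`).

For (ii) ⇒ (i), the minorant `g` is the supremum of the quadratic minorants given by (ii). It
supports `φ` at every attentive subgradient, so one inclusion of graphs is immediate. For the other,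
let `xs` be a subgradient of `g` at `x`, close to `(x₀, xs₀)`. Minimizing `φ - xs + ‖· - x‖ ^ 2 / 2`
approximately over a ball gives a point `y` and a regular subgradient `us = xs - (p + s)` of `φ` at
`y`, with `p` comparable to a duality functional of `y - x` and `‖s‖ ≤ δ`. Now `us` at `y` and `xs`
at `x` are both subgradients of `g`, where `g` takes the value `φ y` at `y`, and monotonicity forces
`p (y - x) ≤ δ * ‖y - x‖`. Hence `y` is within `4 * δ` of `x` and `us` within `9 * δ` of `xs`.
Letting `δ → 0` puts `(x, xs)` in the graph of the subdifferential of `φ`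
(`mem_limitingSubdiff_of_supporting`).

Such a `us` requires a Fréchet differentiable substitute for the squared norm
(`exists_regular_subgradient`). By Šmulian's principle, a conjugate function is Fréchet
differentiable where its supremum has a strong maximizer. Adding to `‖p‖ ^ 2` the weighted squared
distances to countably many lines `ℝ (q m)` makes a maximizer strong as soon as it lies in the
closure of the `q m`. The directions are therefore chosen along a Borwein–Preiss iteration, so that
they become dense in the spaces spanned by the near-maximizers met on the way. By reflexivity, weak
limits of these near-maximizers remain in the norm closure, which covers all maximizers needed at
the limit point. -/

namespace VarConvex

variable {X : Type*} [NormedAddCommGroup X] [NormedSpace ℝ X]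

/-! ### Functions on the dual that are rotund along countably many directions. -/

/-- The norm of the restriction of `p` to the kernel of `q`, i.e. the distance from `p` to the line
spanned by `q`. -/
noncomputable def kerSeminorm (q p : StrongDual ℝ X) : ℝ :=
  ‖p.comp (LinearMap.ker (q : X →ₗ[ℝ] ℝ)).subtypeL‖

lemma kerSeminorm_nonneg (q p : StrongDual ℝ X) : 0 ≤ kerSeminorm q p :=
  norm_nonneg (p.comp (LinearMap.ker (q : X →ₗ[ℝ] ℝ)).subtypeL)

lemma kerSeminorm_le_norm (q p : StrongDual ℝ X) : kerSeminorm q p ≤ ‖p‖ := by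
  refine ContinuousLinearMap.opNorm_le_bound _ (norm_nonneg _) fun v => ?_
  exact p.le_opNorm v

lemma kerSeminorm_le_of_forall {q p : StrongDual ℝ X} {C : ℝ} (hC : 0 ≤ C)
    (h : ∀ v, q v = 0 → |p v| ≤ C * ‖v‖) : kerSeminorm q p ≤ C :=
  ContinuousLinearMap.opNorm_le_bound _ hC fun v => h v v.2

lemma abs_apply_le_kerSeminorm {q : StrongDual ℝ X} (p : StrongDual ℝ X) {v : X} (hv : q v = 0) :
    |p v| ≤ kerSeminorm q p * ‖v‖ :=
  (p.comp (LinearMap.ker (q : X →ₗ[ℝ] ℝ)).subtypeL).le_opNorm ⟨v, hv⟩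

lemma kerSeminorm_self (q : StrongDual ℝ X) : kerSeminorm q q = 0 :=
  le_antisymm (kerSeminorm_le_of_forall le_rfl fun v hv => by simp [hv]) (kerSeminorm_nonneg _ _)

lemma kerSeminorm_le_add (q p p' : StrongDual ℝ X) :
    kerSeminorm q p ≤ kerSeminorm q p' + ‖p - p'‖ := by
  have h := kerSeminorm_le_norm q (p - p')
  have h2 : kerSeminorm q p ≤ kerSeminorm q p' + kerSeminorm q (p - p') := by
    have := norm_add_le (p'.comp (LinearMap.ker (q : X →ₗ[ℝ] ℝ)).subtypeL)
      ((p - p').comp (LinearMap.ker (q : X →ₗ[ℝ] ℝ)).subtypeL)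
    rwa [← ContinuousLinearMap.add_comp, add_sub_cancel] at this
  linarith

lemma kerSeminorm_midpoint_le (q p p' : StrongDual ℝ X) :
    kerSeminorm q ((1 / 2 : ℝ) • (p + p')) ≤ (kerSeminorm q p + kerSeminorm q p') / 2 := by
  refine kerSeminorm_le_of_forall
    (by linarith [kerSeminorm_nonneg q p, kerSeminorm_nonneg q p']) fun v hv => ?_
  have h1 := abs_le.1 (abs_apply_le_kerSeminorm p hv)
  have h2 := abs_le.1 (abs_apply_le_kerSeminorm p' hv)
  simp only [smul_apply, add_apply, smul_eq_mul]
  rw [abs_le]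
  constructor <;> linarith [h1.1, h1.2, h2.1, h2.2]

/-- A norm-preserving extension of the restriction of `p` to `ker q` differs from `p` by a
functional vanishing on `ker q`, that is, by a multiple of `q`. -/
lemma exists_norm_sub_smul_le (q p : StrongDual ℝ X) :
    ∃ t : ℝ, ‖p - t • q‖ ≤ kerSeminorm q p := by
  obtain ⟨g, hg, hgn⟩ := exists_extension_norm_eq (LinearMap.ker (q : X →ₗ[ℝ] ℝ))
    (p.comp (LinearMap.ker (q : X →ₗ[ℝ] ℝ)).subtypeL)
  have hker : LinearMap.ker (q : X →ₗ[ℝ] ℝ) ≤ LinearMap.ker ((p - g : StrongDual ℝ X) : X →ₗ[ℝ] ℝ) := by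
    intro v hv
    have := hg ⟨v, hv⟩
    simp at this ⊢
    rw [this, sub_self]
  obtain ⟨t, ht⟩ : ∃ t : ℝ, p - g = t • q := by
    by_cases hq : q = 0
    · refine ⟨0, ?_⟩
      ext v
      have : v ∈ LinearMap.ker (q : X →ₗ[ℝ] ℝ) := by simp [hq]
      simpa using hker this
    · obtain ⟨v, hv⟩ : ∃ v, q v ≠ 0 := by
        by_contra! h
        exact hq (ContinuousLinearMap.ext h)
      refine ⟨(p - g) v / q v, ?_⟩
      ext w
      have : w - (q w / q v) • v ∈ LinearMap.ker (q : X →ₗ[ℝ] ℝ) := by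
        simp [hv]
      have := hker this
      simp only [LinearMap.mem_ker, map_sub, map_smul, ContinuousLinearMap.coe_coe, smul_eq_mul,
        smul_apply] at this ⊢
      rw [sub_eq_zero] at this
      rw [this]; ring
  refine ⟨t, ?_⟩
  rw [← ht, sub_sub_cancel, hgn]
  rfl

/-- Summable weights. -/
noncomputable def weight (m : ℕ) : ℝ := (1 / 8) ^ m / 2

lemma weight_pos (m : ℕ) : 0 < weight m := by unfold weight; positivity

lemma summable_weight : Summable weight :=
  (summable_geometric_of_lt_one (by norm_num) (by norm_num)).div_const 2

lemma tsum_weight_add_le (n : ℕ) : ∑' m, weight (m + n) ≤ (1 / 8) ^ n := by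
  have : ∀ m, weight (m + n) = ((1 / 8) ^ n / 2) * (1 / 8) ^ m := fun m => by
    unfold weight; ring
  simp_rw [this]
  rw [tsum_mul_left, tsum_geometric_of_lt_one (by norm_num) (by norm_num)]
  have : (0 : ℝ) < (1 / 8) ^ n := by positivity
  norm_num
  linarith

/-- A convex function on the dual, between `‖p‖² / 2` and `‖p‖²`, that is rotund in the directions
`q m`. -/
noncomputable def rotund (q : ℕ → StrongDual ℝ X) (p : StrongDual ℝ X) : ℝ :=
  (‖p‖ ^ 2 + ∑' m, weight m * kerSeminorm (q m) p ^ 2) / 2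

lemma weight_mul_kerSeminorm_le (q : ℕ → StrongDual ℝ X) (p : StrongDual ℝ X) (m : ℕ) :
    weight m * kerSeminorm (q m) p ^ 2 ≤ weight m * ‖p‖ ^ 2 := by
  have := kerSeminorm_le_norm (q m) p
  have := kerSeminorm_nonneg (q m) p
  have := weight_pos m
  gcongr

lemma weight_mul_kerSeminorm_nonneg (q : ℕ → StrongDual ℝ X) (p : StrongDual ℝ X) (m : ℕ) :
    0 ≤ weight m * kerSeminorm (q m) p ^ 2 :=
  mul_nonneg (weight_pos m).le (sq_nonneg _)

lemma summable_rotund (q : ℕ → StrongDual ℝ X) (p : StrongDual ℝ X) :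
    Summable fun m => weight m * kerSeminorm (q m) p ^ 2 :=
  Summable.of_nonneg_of_le (weight_mul_kerSeminorm_nonneg q p) (weight_mul_kerSeminorm_le q p)
    (summable_weight.mul_right _)

lemma half_norm_sq_le_rotund (q : ℕ → StrongDual ℝ X) (p : StrongDual ℝ X) :
    ‖p‖ ^ 2 / 2 ≤ rotund q p := by
  have : 0 ≤ ∑' m, weight m * kerSeminorm (q m) p ^ 2 :=
    tsum_nonneg (weight_mul_kerSeminorm_nonneg q p)
  unfold rotund
  linarith

lemma rotund_nonneg (q : ℕ → StrongDual ℝ X) (p : StrongDual ℝ X) : 0 ≤ rotund q p :=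
  le_trans (by positivity) (half_norm_sq_le_rotund q p)

lemma rotund_le_norm_sq (q : ℕ → StrongDual ℝ X) (p : StrongDual ℝ X) :
    rotund q p ≤ ‖p‖ ^ 2 := by
  have h1 : ∑' m, weight m * kerSeminorm (q m) p ^ 2 ≤ ∑' m, weight m * ‖p‖ ^ 2 :=
    (summable_rotund q p).tsum_le_tsum (weight_mul_kerSeminorm_le q p)
      (summable_weight.mul_right _)
  rw [tsum_mul_right] at h1
  have h2 := tsum_weight_add_le 0
  simp only [add_zero, pow_zero] at h2
  unfold rotund
  nlinarith [sq_nonneg ‖p‖]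

/-- Only the tail of the weights sees the change. This stability allows later directions to be
chosen after earlier points, at a cost matching the `(1 / 8) ^ n` tolerances of the iteration. -/
lemma rotund_le_add_of_agree {q q' : ℕ → StrongDual ℝ X} {n : ℕ} (h : ∀ m < n, q m = q' m)
    (p : StrongDual ℝ X) : rotund q p ≤ rotund q' p + ‖p‖ ^ 2 * (1 / 8) ^ n := by
  have h1 := (summable_rotund q p).sum_add_tsum_nat_add n
  have h2 := (summable_rotund q' p).sum_add_tsum_nat_add n
  have h3 : ∑ m ∈ Finset.range n, weight m * kerSeminorm (q m) p ^ 2 =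
      ∑ m ∈ Finset.range n, weight m * kerSeminorm (q' m) p ^ 2 :=
    Finset.sum_congr rfl fun m hm => by rw [h m (Finset.mem_range.1 hm)]
  have h4 : ∑' m, weight (m + n) * kerSeminorm (q (m + n)) p ^ 2 ≤
      ∑' m, weight (m + n) * ‖p‖ ^ 2 :=
    ((summable_nat_add_iff n).2 (summable_rotund q p)).tsum_le_tsum
      (fun m => weight_mul_kerSeminorm_le q p (m + n))
      (((summable_nat_add_iff n).2 summable_weight).mul_right _)
  rw [tsum_mul_right] at h4
  have h5 : 0 ≤ ∑' m, weight (m + n) * kerSeminorm (q' (m + n)) p ^ 2 :=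
    tsum_nonneg fun m => weight_mul_kerSeminorm_nonneg q' p (m + n)
  have h6 := mul_le_mul_of_nonneg_right (tsum_weight_add_le n) (sq_nonneg ‖p‖)
  have h7 : (0 : ℝ) ≤ ‖p‖ ^ 2 * (1 / 8) ^ n := by positivity
  unfold rotund
  linarith

lemma quarter_sq_sub_le {a b m : ℝ} (hm : 0 ≤ m) (h : m ≤ (a + b) / 2) :
    (a - b) ^ 2 / 4 ≤ (a ^ 2 + b ^ 2) / 2 - m ^ 2 := by
  nlinarith

/-- The convexity gap of `rotund q` at a midpoint controls those of its constituents. -/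
lemma sq_sub_le_gap (q : ℕ → StrongDual ℝ X) (p p' : StrongDual ℝ X) :
    (‖p‖ - ‖p'‖) ^ 2 / 8 ≤
      (rotund q p + rotund q p') / 2 - rotund q ((1 / 2 : ℝ) • (p + p')) ∧
    ∀ m, weight m * (kerSeminorm (q m) p - kerSeminorm (q m) p') ^ 2 / 8 ≤
      (rotund q p + rotund q p') / 2 - rotund q ((1 / 2 : ℝ) • (p + p')) := by
  set M := (1 / 2 : ℝ) • (p + p')
  have hM : ‖M‖ ≤ (‖p‖ + ‖p'‖) / 2 := by
    have := norm_add_le p p'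
    simp only [M, norm_smul]
    norm_num
    linarith
  have hn := quarter_sq_sub_le (norm_nonneg M) hM
  have hk : ∀ m, weight m * (kerSeminorm (q m) p - kerSeminorm (q m) p') ^ 2 / 4 ≤
      weight m * ((kerSeminorm (q m) p ^ 2 + kerSeminorm (q m) p' ^ 2) / 2
        - kerSeminorm (q m) M ^ 2) := fun m => by
    have := mul_le_mul_of_nonneg_left (quarter_sq_sub_le (kerSeminorm_nonneg (q m) M)
      (kerSeminorm_midpoint_le (q m) p p')) (weight_pos m).le
    linarith
  have hs := (((summable_rotund q p).hasSum.add (summable_rotund q p').hasSum).mul_left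
    (1 / 2)).sub (summable_rotund q M).hasSum
  have hnn : ∀ m, 0 ≤ 1 / 2 * (weight m * kerSeminorm (q m) p ^ 2 +
      weight m * kerSeminorm (q m) p' ^ 2) - weight m * kerSeminorm (q m) M ^ 2 := fun m => by
    have := hk m
    have := mul_nonneg (weight_pos m).le (sq_nonneg (kerSeminorm (q m) p - kerSeminorm (q m) p'))
    linarith
  have h0 := hs.nonneg hnn
  refine ⟨?_, fun m => ?_⟩
  · unfold rotund
    linarith
  · have h1 := le_hasSum hs m fun j _ => hnn j
    have h2 := hk m
    have h3 := sq_nonneg (‖p‖ - ‖p'‖)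
    unfold rotund
    linarith

/-! ### The conjugate penalty and its Fréchet superdifferentiability. -/

/-- The conjugate of `rotund q`, a perturbation of `‖z‖² / 2`. -/
noncomputable def penalty (q : ℕ → StrongDual ℝ X) (z : X) : ℝ :=
  ⨆ p : StrongDual ℝ X, (p z - rotund q p)

lemma apply_sub_rotund_le (q : ℕ → StrongDual ℝ X) (p : StrongDual ℝ X) (z : X) :
    p z - rotund q p ≤ ‖p‖ * ‖z‖ - ‖p‖ ^ 2 / 2 := by
  have h1 := half_norm_sq_le_rotund q p
  have h2 := (le_abs_self _).trans (p.le_opNorm z)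
  linarith

lemma bddAbove_penalty (q : ℕ → StrongDual ℝ X) (z : X) :
    BddAbove (Set.range fun p : StrongDual ℝ X => p z - rotund q p) := by
  refine ⟨‖z‖ ^ 2 / 2, ?_⟩
  rintro _ ⟨p, rfl⟩
  have := apply_sub_rotund_le q p z
  simp only
  nlinarith [sq_nonneg (‖p‖ - ‖z‖)]

lemma le_penalty (q : ℕ → StrongDual ℝ X) (p : StrongDual ℝ X) (z : X) :
    p z - rotund q p ≤ penalty q z :=
  le_ciSup (bddAbove_penalty q z) p

lemma penalty_le_half (q : ℕ → StrongDual ℝ X) (z : X) : penalty q z ≤ ‖z‖ ^ 2 / 2 := by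
  refine ciSup_le fun p => ?_
  have := apply_sub_rotund_le q p z
  nlinarith [sq_nonneg (‖p‖ - ‖z‖)]

lemma quarter_le_penalty (q : ℕ → StrongDual ℝ X) (z : X) : ‖z‖ ^ 2 / 4 ≤ penalty q z := by
  obtain ⟨g, hg, hgz⟩ := exists_dual_vector'' ℝ z
  have h1 := le_penalty q ((‖z‖ / 2) • g) z
  have h2 := rotund_le_norm_sq q ((‖z‖ / 2) • g)
  have h3 : ‖(‖z‖ / 2) • g‖ ≤ ‖z‖ / 2 := by
    rw [norm_smul, Real.norm_of_nonneg (by positivity)]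
    nlinarith [norm_nonneg z]
  have h4 : ((‖z‖ / 2) • g) z = ‖z‖ ^ 2 / 2 := by
    simp [hgz]; ring
  nlinarith [norm_nonneg ((‖z‖ / 2) • g)]

lemma penalty_nonneg (q : ℕ → StrongDual ℝ X) (z : X) : 0 ≤ penalty q z :=
  le_trans (by positivity) (quarter_le_penalty q z)

lemma penalty_zero (q : ℕ → StrongDual ℝ X) : penalty q (0 : X) = 0 :=
  le_antisymm (by simpa using penalty_le_half q (0 : X)) (penalty_nonneg _ _)

lemma exists_near_penalty (q : ℕ → StrongDual ℝ X) (z : X) {e : ℝ} (he : 0 < e) :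
    ∃ p : StrongDual ℝ X, penalty q z - e < p z - rotund q p :=
  exists_lt_of_lt_ciSup (sub_lt_self _ he)

lemma norm_le_of_near_penalty {q : ℕ → StrongDual ℝ X} {p : StrongDual ℝ X} {z : X}
    (h : -1 ≤ p z - rotund q p) : ‖p‖ ≤ 2 * ‖z‖ + 2 := by
  have := apply_sub_rotund_le q p z
  by_contra! h'
  nlinarith [norm_nonneg z, norm_nonneg p]

lemma norm_le_of_eq_penalty {q : ℕ → StrongDual ℝ X} {p : StrongDual ℝ X} {z : X}
    (h : 0 ≤ p z - rotund q p) : ‖p‖ ≤ 2 * ‖z‖ := by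
  have := apply_sub_rotund_le q p z
  by_contra! h'
  nlinarith [norm_nonneg z, norm_nonneg p]

lemma penalty_le_add_of_agree {q q' : ℕ → StrongDual ℝ X} {n : ℕ} (h : ∀ m < n, q m = q' m)
    (z : X) : penalty q z ≤ penalty q' z + 4 * ‖z‖ ^ 2 * (1 / 8) ^ n := by
  have h8 : (0 : ℝ) < (1 / 8) ^ n := by positivity
  refine ciSup_le fun p => ?_
  by_cases hp : 0 ≤ p z - rotund q p
  · have h1 := norm_le_of_eq_penalty hp
    have h2 := rotund_le_add_of_agree (fun m hm => (h m hm).symm) p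
    have h3 := le_penalty q' p z
    have h4 : ‖p‖ ^ 2 ≤ 4 * ‖z‖ ^ 2 := by nlinarith [norm_nonneg p]
    have h5 := mul_le_mul_of_nonneg_right h4 h8.le
    linarith
  · have h1 := penalty_nonneg q' z
    have : (0 : ℝ) ≤ 4 * ‖z‖ ^ 2 * (1 / 8) ^ n := by positivity
    linarith

/-- Near-maximizers at `z` have norm at most `2 * ‖z‖ + 2`, and testing one of them at `z'` gives
the Lipschitz bound. -/
lemma penalty_sub_le (q : ℕ → StrongDual ℝ X) (z z' : X) :
    penalty q z - penalty q z' ≤ (2 * ‖z‖ + 2) * ‖z - z'‖ := by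
  refine le_of_forall_pos_le_add fun e he => ?_
  obtain ⟨p, hp⟩ := exists_near_penalty q z (lt_min he one_pos)
  have h1 : ‖p‖ ≤ 2 * ‖z‖ + 2 := norm_le_of_near_penalty (q := q) (by
    have := penalty_nonneg q z
    have := min_le_right e 1
    linarith)
  have h2 := le_penalty q p z'
  have h3 : p z - p z' ≤ ‖p‖ * ‖z - z'‖ := by
    rw [← map_sub]
    exact (le_abs_self _).trans (p.le_opNorm _)
  have h4 := mul_le_mul_of_nonneg_right h1 (norm_nonneg (z - z'))
  have := min_le_left e 1
  linarith

/-- A maximizer in the closure of the rotund directions is a strong maximizer. -/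
lemma exists_strong_max {q : ℕ → StrongDual ℝ X} {p₀ : StrongDual ℝ X} {z : X}
    (hp₀ : penalty q z ≤ p₀ z - rotund q p₀) (hcl : p₀ ∈ closure (Set.range q)) {η : ℝ}
    (hη : 0 < η) :
    ∃ τ > 0, ∀ p : StrongDual ℝ X, penalty q z - τ ≤ p z - rotund q p → ‖p - p₀‖ ≤ η := by
  by_cases hz : z = 0
  · subst hz
    refine ⟨η ^ 2 / 2, by positivity, fun p hp => ?_⟩
    have h0 : p₀ = 0 := by
      have := norm_le_of_eq_penalty (le_trans (penalty_nonneg _ _) hp₀)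
      simpa using this
    rw [penalty_zero, map_zero] at hp
    have := half_norm_sq_le_rotund q p
    rw [h0, sub_zero]
    nlinarith [norm_nonneg p]
  have hz' : 0 < ‖z‖ := norm_pos_iff.2 hz
  -- The final triangle inequality adds `2 * e + 4 * e + e`, whence `η / 7`; the bound `‖z‖ / 16`
  -- serves only to fix the sign of `t`.
  set e := min (η / 7) (‖z‖ / 16)
  have he0 : 0 < e := by positivity
  have he1 : e ≤ η / 7 := min_le_left _ _
  have he2 : e ≤ ‖z‖ / 16 := min_le_right _ _
  obtain ⟨_, ⟨m, rfl⟩, hm⟩ := Metric.mem_closure_iff.1 hcl e he0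
  rw [dist_eq_norm] at hm
  have hw := weight_pos m
  have hw1 : weight m ≤ 1 := by
    unfold weight
    have : ((1 : ℝ) / 8) ^ m ≤ 1 := pow_le_one₀ (by norm_num) (by norm_num)
    linarith
  -- Two `τ`-maximizers have midpoint gap at most `τ / 2`, so this `τ` makes both their norms and
  -- their distances to `ℝ (q m)` agree up to `e`.
  set τ := min (‖z‖ ^ 2 / 16) (weight m * e ^ 2 / 4)
  have hτ0 : 0 < τ := by positivity
  have hτ1 : τ ≤ ‖z‖ ^ 2 / 16 := min_le_left _ _
  have hτ2 : τ ≤ weight m * e ^ 2 / 4 := min_le_right _ _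
  refine ⟨τ, hτ0, fun p hp => ?_⟩
  obtain ⟨g1, g2⟩ := sq_sub_le_gap q p p₀
  have gap : (rotund q p + rotund q p₀) / 2 - rotund q ((1 / 2 : ℝ) • (p + p₀)) ≤ τ / 2 := by
    have := le_penalty q ((1 / 2 : ℝ) • (p + p₀)) z
    simp only [smul_apply, add_apply, smul_eq_mul] at this
    linarith
  have k1 : |‖p‖ - ‖p₀‖| ≤ e := by
    refine abs_le_of_sq_le_sq ?_ he0.le
    nlinarith [sq_nonneg e]
  have k2 : |kerSeminorm (q m) p - kerSeminorm (q m) p₀| ≤ e := by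
    refine abs_le_of_sq_le_sq ?_ he0.le
    have := g2 m
    by_contra! h
    nlinarith [mul_lt_mul_of_pos_left h hw]
  have k3 : kerSeminorm (q m) p₀ ≤ e := by
    have := kerSeminorm_le_add (q m) p₀ (q m)
    rw [kerSeminorm_self] at this
    linarith
  obtain ⟨t, ht⟩ := exists_norm_sub_smul_le (q m) p
  have k4 : ‖p - t • q m‖ ≤ 2 * e := by linarith [(abs_le.1 k2).2]
  have k5 : |(|t| - 1)| * ‖q m‖ ≤ 4 * e := by
    have a1 := abs_norm_sub_norm_le p (t • q m)
    have a2 := abs_norm_sub_norm_le p₀ (q m)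
    rw [norm_smul, Real.norm_eq_abs] at a1
    have a3 : |(|t| - 1)| * ‖q m‖ = |(|t| * ‖q m‖ - ‖q m‖)| := by
      rw [← sub_one_mul, abs_mul, abs_of_nonneg (norm_nonneg (q m))]
    rw [a3]
    rw [abs_le] at a1 a2 k1 ⊢
    constructor <;> linarith [a1.1, a1.2, a2.1, a2.2, k1.1, k1.2]
  have hpz : ‖z‖ ^ 2 / 4 - τ ≤ p z := by
    linarith [quarter_le_penalty q z, rotund_nonneg q p]
  have hp₀z : ‖z‖ ^ 2 / 4 ≤ p₀ z := by
    linarith [quarter_le_penalty q z, rotund_nonneg q p₀]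
  -- The distances determine `t` only up to sign, as `p` lies near the line of `q m` with almost the
  -- same norm. Both `p` and `p₀` are bounded below at `z` by a positive multiple of `‖z‖ ^ 2`,
  -- which excludes the reflected point.
  have ht0 : 0 ≤ t := by
    by_contra! hneg
    have b1 : p z - t * q m z ≤ 2 * e * ‖z‖ := by
      have := (le_abs_self _).trans ((p - t • q m).le_opNorm z)
      have := mul_le_mul_of_nonneg_right k4 hz'.le
      simp only [sub_apply, smul_apply,
        smul_eq_mul] at *
      linarith
    have b2 : p₀ z - q m z ≤ e * ‖z‖ := by
      have := (le_abs_self _).trans ((p₀ - q m).le_opNorm z)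
      have := mul_le_mul_of_nonneg_right hm.le hz'.le
      simp only [sub_apply] at *
      linarith
    have b3 := mul_le_mul_of_nonneg_right he2 hz'.le
    have b4 : 0 < q m z := by nlinarith
    nlinarith
  rw [abs_of_nonneg ht0] at k5
  have k6 : ‖p - p₀‖ ≤ ‖p - t • q m‖ + ‖(t - 1) • q m‖ + ‖p₀ - q m‖ := by
    have : p - p₀ = (p - t • q m) + (t - 1) • q m - (p₀ - q m) := by
      module
    rw [this]
    exact (norm_sub_le _ _).trans (by gcongr; exact norm_add_le _ _)
  rw [norm_smul, Real.norm_eq_abs] at k6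
  linarith

/-- Fréchet superdifferentiability of `penalty q`. -/
lemma penalty_superdifferentiable {q : ℕ → StrongDual ℝ X} {p₀ : StrongDual ℝ X} {z : X}
    (hp₀ : penalty q z ≤ p₀ z - rotund q p₀) (hcl : p₀ ∈ closure (Set.range q)) {η : ℝ}
    (hη : 0 < η) :
    ∀ᶠ h in 𝓝 (0 : X), penalty q (z + h) ≤ penalty q z + p₀ h + η * ‖h‖ := by
  obtain ⟨τ, hτ, H⟩ := exists_strong_max hp₀ hcl hη
  have hρ : 0 < τ / (4 * (‖p₀‖ + 2 * ‖z‖ + 4 + 1)) := by positivity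
  have hC : 0 < ‖p₀‖ + 2 * ‖z‖ + 4 + 1 := by positivity
  filter_upwards [Metric.ball_mem_nhds (0 : X) (lt_min hρ one_pos)] with h hh
  rw [mem_ball_zero_iff, lt_min_iff, lt_div_iff₀ (by positivity)] at hh
  obtain ⟨hh1, hh2⟩ := hh
  refine le_of_forall_pos_le_add fun e he => ?_
  have he' : 0 < min e (min τ 1) := by positivity
  obtain ⟨p, hp⟩ := exists_near_penalty q (z + h) (half_pos he')
  have e1 : min e (min τ 1) ≤ e := min_le_left _ _
  have e2 : min e (min τ 1) ≤ τ := (min_le_right _ _).trans (min_le_left _ _)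
  have e3 : min e (min τ 1) ≤ 1 := (min_le_right _ _).trans (min_le_right _ _)
  have hpn : ‖p‖ ≤ 2 * ‖z + h‖ + 2 := norm_le_of_near_penalty (q := q) (by
    linarith [penalty_nonneg q (z + h)])
  have hzh := norm_add_le z h
  have hlow := le_penalty q p₀ (z + h)
  have h1 := (abs_le.1 (p₀.le_opNorm h)).1
  have h2 := (abs_le.1 (p.le_opNorm h)).2
  have h3 : ‖p‖ * ‖h‖ ≤ (2 * ‖z‖ + 4) * ‖h‖ := by
    gcongr; linarith
  rw [map_add] at hp hlow
  have hn := norm_nonneg h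
  -- A near-maximizer at `z + h` is a `τ`-maximizer at `z` for small `h`, hence within `η` of `p₀`;
  -- its value then bounds `penalty q (z + h)`.
  have hd := H p (by nlinarith)
  have h4 := (le_abs_self _).trans ((p - p₀).le_opNorm h)
  have h5 := mul_le_mul_of_nonneg_right hd hn
  have h6 := le_penalty q p z
  simp only [sub_apply] at h4
  linarith

/-! ### Weak limits of functionals and varying directions. -/

lemma kerSeminorm_zero_left (p : StrongDual ℝ X) : kerSeminorm 0 p = ‖p‖ :=
  le_antisymm (kerSeminorm_le_norm 0 p) (p.opNorm_le_bound (kerSeminorm_nonneg _ _) fun _ =>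
    abs_apply_le_kerSeminorm p rfl)

section WeakLimits

variable {ι : Type*} {l : Filter ι} {pn : ι → StrongDual ℝ X} {p : StrongDual ℝ X}

/-- Weak-star lower semicontinuity: a vector of `ker q` nearly attaining the seminorm of `p` also
tests `pn n` eventually. The case `q = 0` is that of the dual norm. -/
lemma eventually_kerSeminorm_sq_le (h : ∀ v, Tendsto (fun n => pn n v) l (𝓝 (p v)))
    (q : StrongDual ℝ X) {η : ℝ} (hη : 0 < η) :
    ∀ᶠ n in l, kerSeminorm q p ^ 2 ≤ kerSeminorm q (pn n) ^ 2 + η := by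
  by_cases ha : kerSeminorm q p ^ 2 ≤ η
  · exact Eventually.of_forall fun n => by nlinarith [sq_nonneg (kerSeminorm q (pn n))]
  push Not at ha
  have hs : Real.sqrt (kerSeminorm q p ^ 2 - η) ^ 2 = kerSeminorm q p ^ 2 - η :=
    Real.sq_sqrt (by linarith)
  set c := Real.sqrt (kerSeminorm q p ^ 2 - η)
  have hc0 : 0 ≤ c := Real.sqrt_nonneg _
  have hc : c < kerSeminorm q p := by nlinarith [kerSeminorm_nonneg q p]
  obtain ⟨v, hv, hcv⟩ : ∃ v, q v = 0 ∧ c * ‖v‖ < |p v| := by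
    by_contra! hcon
    exact absurd (kerSeminorm_le_of_forall hc0 hcon) (not_le.2 hc)
  filter_upwards [(h v).abs.eventually (lt_mem_nhds hcv)] with n hn
  have h1 := hn.trans_le (abs_apply_le_kerSeminorm (pn n) hv)
  have h2 : c < kerSeminorm q (pn n) := lt_of_mul_lt_mul_right h1 (norm_nonneg v)
  nlinarith

/-- In a reflexive space, closed convex sets of functionals are closed under pointwise limits. -/
lemma mem_of_pointwise_limit (hX : IsReflexiveSpace X) [NeBot l] {Z : Set (StrongDual ℝ X)}
    (hZ : IsClosed Z) (hZc : Convex ℝ Z)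
    (h : ∀ v, Tendsto (fun n => pn n v) l (𝓝 (p v))) (hp : ∀ᶠ n in l, pn n ∈ Z) : p ∈ Z := by
  by_contra hcon
  obtain ⟨f, u, hf, hu⟩ := geometric_hahn_banach_closed_point hZc hZ hcon
  obtain ⟨v, rfl⟩ := hX f
  have := le_of_tendsto (h v) (hp.mono fun n hn => (hf _ hn).le)
  exact absurd hu (not_lt.2 this)

end WeakLimits

/-- Banach–Alaoglu along an ultrafilter, which avoids extracting subsequences. -/
lemma exists_pointwise_limit {pn : ℕ → StrongDual ℝ X} {C : ℝ} (h : ∀ n, ‖pn n‖ ≤ C) :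
    ∃ p : StrongDual ℝ X,
      ∀ v, Tendsto (fun n => pn n v) (hyperfilter ℕ : Filter ℕ) (𝓝 (p v)) := by
  have hc := WeakDual.isCompact_closedBall (0 : StrongDual ℝ X) C
  obtain ⟨p, -, hp⟩ := hc.ultrafilter_le_nhds
    ((hyperfilter ℕ).map fun n => StrongDual.toWeakDual (pn n)) (by
      refine le_principal_iff.2 (Filter.mem_map.2 (Filter.univ_mem' fun n => ?_))
      simpa using h n)
  refine ⟨WeakDual.toStrongDual p, fun v => ?_⟩
  have : Tendsto (fun n => StrongDual.toWeakDual (pn n)) (hyperfilter ℕ : Filter ℕ) (𝓝 p) := hp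
  exact ((WeakDual.eval_continuous v).tendsto p).comp this

section Limits

variable {l : Filter ℕ} {qn : ℕ → ℕ → StrongDual ℝ X} {q : ℕ → StrongDual ℝ X}
  {zn : ℕ → X} {z : X}

lemma tendsto_penalty (hl : l ≤ atTop) (hq : ∀ n, ∀ m < n, qn n m = q m)
    (hz : Tendsto zn l (𝓝 z)) :
    Tendsto (fun n => penalty (qn n) (zn n)) l (𝓝 (penalty q z)) := by
  have hpow : Tendsto (fun n : ℕ => (1 / 8 : ℝ) ^ n) l (𝓝 0) :=
    (tendsto_pow_atTop_nhds_zero_of_lt_one (by norm_num) (by norm_num)).mono_left hl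
  have hb : Tendsto (fun n => 4 * ‖zn n‖ ^ 2 * (1 / 8) ^ n +
      (2 * ‖zn n‖ + 2 + (2 * ‖z‖ + 2)) * ‖zn n - z‖) l (𝓝 0) := by
    have h1 := ((hz.norm.pow 2).const_mul 4).mul hpow
    have h2 := ((((hz.norm.const_mul 2).add_const 2).add_const (2 * ‖z‖ + 2))).mul
      (hz.sub_const z).norm
    simpa using h1.add h2
  rw [tendsto_iff_norm_sub_tendsto_zero]
  refine squeeze_zero (fun _ => norm_nonneg _) (fun n => ?_) hb
  rw [Real.norm_eq_abs, abs_le]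
  have h1 := penalty_le_add_of_agree (hq n) (zn n)
  have h2 := penalty_le_add_of_agree (fun m hm => (hq n m hm).symm) (zn n)
  have h3 := penalty_sub_le q (zn n) z
  have h4 := penalty_sub_le q z (zn n)
  rw [norm_sub_rev] at h4
  have h5 : 0 ≤ (2 * ‖zn n‖ + 2) * ‖zn n - z‖ := by positivity
  have h6 : 0 ≤ (2 * ‖z‖ + 2) * ‖zn n - z‖ := by positivity
  rw [add_mul (2 * ‖zn n‖ + 2)]
  constructor <;> linarith

/-- The values `pn n (zn n)` and the penalties converge, while `rotund` is lower semicontinuous. The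
latter is checked on finite partial sums, whose directions eventually agree with `q`. -/
lemma penalty_attained_of_limit [NeBot l] (hl : l ≤ atTop) (hq : ∀ n, ∀ m < n, qn n m = q m)
    (hz : Tendsto zn l (𝓝 z)) {pn : ℕ → StrongDual ℝ X} {p : StrongDual ℝ X} {C : ℝ}
    (hC : ∀ n, ‖pn n‖ ≤ C) (hp : ∀ v, Tendsto (fun n => pn n v) l (𝓝 (p v)))
    {e : ℕ → ℝ} (he : Tendsto e l (𝓝 0))
    (h : ∀ᶠ n in l, penalty (qn n) (zn n) - e n ≤ pn n (zn n) - rotund (qn n) (pn n)) :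
    penalty q z ≤ p z - rotund q p := by
  have hpz : Tendsto (fun n => pn n (zn n)) l (𝓝 (p z)) := by
    have h1 : Tendsto (fun n => pn n (zn n - z)) l (𝓝 0) := by
      refine squeeze_zero_norm (a := fun n => C * ‖zn n - z‖) (fun n => ?_) ?_
      · exact ((pn n).le_opNorm _).trans (mul_le_mul_of_nonneg_right (hC n) (norm_nonneg _))
      · simpa using ((hz.sub_const z).norm.const_mul C)
    simpa using h1.add (hp z)
  have hpen := tendsto_penalty hl hq hz
  have key : ∀ M, (‖p‖ ^ 2 + ∑ m ∈ Finset.range M, weight m * kerSeminorm (q m) p ^ 2) / 2 ≤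
      p z - penalty q z := by
    intro M
    refine le_of_forall_pos_le_add fun η hη => ?_
    have ev1 := eventually_kerSeminorm_sq_le hp 0 hη
    have ev2 : ∀ᶠ n in l, ∀ m ∈ Finset.range M,
        kerSeminorm (q m) p ^ 2 ≤ kerSeminorm (q m) (pn n) ^ 2 + η :=
      (Finset.eventually_all _).2 fun m _ => eventually_kerSeminorm_sq_le hp (q m) hη
    have hlim : Tendsto (fun n => pn n (zn n) - penalty (qn n) (zn n) + e n + η) l
        (𝓝 (p z - penalty q z + 0 + η)) := ((hpz.sub hpen).add he).add_const η
    rw [add_zero] at hlim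
    refine ge_of_tendsto hlim ?_
    filter_upwards [ev1, ev2, h, hl (eventually_ge_atTop M)] with n h1 h2 h3 h4
    rw [kerSeminorm_zero_left, kerSeminorm_zero_left] at h1
    have h5 : ∑ m ∈ Finset.range M, weight m * kerSeminorm (q m) p ^ 2 ≤
        ∑ m ∈ Finset.range M, weight m * kerSeminorm (qn n m) (pn n) ^ 2 +
          (∑ m ∈ Finset.range M, weight m) * η := by
      rw [Finset.sum_mul, ← Finset.sum_add_distrib]
      refine Finset.sum_le_sum fun m hm => ?_
      rw [hq n m ((Finset.mem_range.1 hm).trans_le h4), ← mul_add]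
      exact mul_le_mul_of_nonneg_left (h2 m hm) (weight_pos m).le
    have h6 := (summable_rotund (qn n) (pn n)).sum_le_tsum (Finset.range M)
      fun m _ => weight_mul_kerSeminorm_nonneg _ _ m
    have h7 : ∑ m ∈ Finset.range M, weight m ≤ 1 := by
      refine (summable_weight.sum_le_tsum _ fun m _ => (weight_pos m).le).trans ?_
      simpa using tsum_weight_add_le 0
    have h8 := mul_le_mul_of_nonneg_right h7 hη.le
    unfold rotund at h3
    linarith
  have hfin : ∑' m, weight m * kerSeminorm (q m) p ^ 2 ≤ 2 * (p z - penalty q z) - ‖p‖ ^ 2 :=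
    (summable_rotund q p).tsum_le_of_sum_range_le fun M => by linarith [key M]
  unfold rotund
  linarith

lemma tendsto_sum_penalty (hl : l ≤ atTop) (hq : ∀ n, ∀ m < n, qn n m = q m)
    (hz : Tendsto zn l (𝓝 z)) {w : ℕ → X} {R : ℝ} (hR : ∀ᶠ n in l, ∀ i, ‖zn n - w i‖ ≤ R)
    {c : ℕ → ℝ} (hc : ∀ i, 0 ≤ c i) (hcs : Summable c) :
    Tendsto (fun n => ∑ i ∈ Finset.range n, c i * penalty (qn n) (zn n - w i)) l
      (𝓝 (∑' i, c i * penalty q (z - w i))) := by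
  have h1 : ∀ n, ∑ i ∈ Finset.range n, c i * penalty (qn n) (zn n - w i) =
      ∑' i, (if i < n then c i * penalty (qn n) (zn n - w i) else 0) := fun n => by
    rw [tsum_eq_sum (s := Finset.range n) fun i hi => if_neg fun h => hi (Finset.mem_range.2 h)]
    exact Finset.sum_congr rfl fun i hi => (if_pos (Finset.mem_range.1 hi)).symm
  simp_rw [h1]
  refine tendsto_tsum_of_dominated_convergence (bound := fun i => c i * (R ^ 2 / 2))
    (hcs.mul_right _) (fun i => ?_) ?_
  · refine ((tendsto_penalty hl hq (hz.sub_const (w i))).const_mul (c i)).congr' ?_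
    filter_upwards [hl (eventually_gt_atTop i)] with n hn
    exact (if_pos hn).symm
  · filter_upwards [hR] with n hn i
    have h2 : penalty (qn n) (zn n - w i) ≤ R ^ 2 / 2 := by
      have := penalty_le_half (qn n) (zn n - w i)
      have := pow_le_pow_left₀ (norm_nonneg _) (hn i) 2
      linarith
    have h3 := penalty_nonneg (qn n) (zn n - w i)
    split_ifs
    · rw [Real.norm_of_nonneg (mul_nonneg (hc i) h3)]
      exact mul_le_mul_of_nonneg_left h2 (hc i)
    · rw [norm_zero]
      exact mul_nonneg (hc i) (by positivity)

end Limits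

/-! ### A Borwein–Preiss iteration with adaptively chosen directions. -/

/-- Construction of a sequence by a choice that depends on the whole history. -/
lemma exists_seq_of_history {A : Type*} [Inhabited A] {R : ℕ → (ℕ → A) → A → Prop}
    (hR : ∀ n h, ∃ a, R n h a) :
    ∃ s : ℕ → A, ∀ n, R n (fun i => if i < n then s i else default) (s n) := by
  choose f hf using hR
  let s : ℕ → A := Nat.lt_wfRel.wf.fix fun n ih =>
    f n fun i => if h : i < n then ih i h else default
  have hs : ∀ n, s n = f n fun i => if i < n then s i else default := fun n => by
    have := Nat.lt_wfRel.wf.fix_eq (C := fun _ => A) (fun n ih =>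
      f n fun i => if h : i < n then ih i h else default) n
    simpa [s] using this
  refine ⟨s, fun n => ?_⟩
  conv => arg 3; rw [hs n]
  exact hf _ _

lemma exists_seq_subset_closure {E : Type*} [TopologicalSpace E] [Nonempty E] {S : Set E}
    (hS : TopologicalSpace.IsSeparable S) : ∃ d : ℕ → E, S ⊆ closure (Set.range d) := by
  obtain ⟨c, hc, hSc⟩ := hS
  obtain ⟨a⟩ := ‹Nonempty E›
  obtain ⟨d, hd⟩ := (hc.insert a).exists_eq_range ⟨a, Set.mem_insert _ _⟩
  exact ⟨d, hSc.trans (closure_mono (hd ▸ Set.subset_insert _ _))⟩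

/-- The sequences behind the variational principle: successive approximate minimizers `w n` of
penalized functions, where the rotund directions `q` eventually exhaust the spaces `S n` containing
all near-maximizers in the definition of the penalties. -/
lemma exists_penalized_sequence {D : Set X} (hD : D.Nonempty) {F : X → ℝ} {b : ℝ}
    (hb : ∀ y ∈ D, b ≤ F y) (x : X) {c : ℕ → ℝ} (hc : ∀ i, 0 ≤ c i) :
    ∃ (w : ℕ → X) (S : ℕ → Submodule ℝ (StrongDual ℝ X)) (q : ℕ → StrongDual ℝ X)
      (qn : ℕ → ℕ → StrongDual ℝ X),
      w 0 = x ∧ (∀ n, n ≠ 0 → w n ∈ D) ∧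
      (∀ n, n ≠ 0 → ∀ y ∈ D,
        F (w n) + ∑ i ∈ Finset.range n, c i * penalty (qn n) (w n - w i) ≤
          F y + ∑ i ∈ Finset.range n, c i * penalty (qn n) (y - w i) + (1 / 8) ^ n) ∧
      (∀ n, ∀ i < n, ∃ p ∈ S n, penalty (qn n) (w n - w i) - (1 / 8) ^ n ≤
        p (w n - w i) - rotund (qn n) p) ∧
      Monotone S ∧ (∀ n, (S n : Set (StrongDual ℝ X)) ⊆ closure (Set.range q)) ∧
      ∀ n, ∀ m < n, qn n m = q m := by
  choose d hd using fun S : {S : Submodule ℝ (StrongDual ℝ X) //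
    TopologicalSpace.IsSeparable (S : Set (StrongDual ℝ X))} => exists_seq_subset_closure S.2
  let A := X × {S : Submodule ℝ (StrongDual ℝ X) //
    TopologicalSpace.IsSeparable (S : Set (StrongDual ℝ X))}
  -- Pairing interleaves the dense sequences of all the spaces. Since `m.unpair.1 ≤ m`, the
  -- directions of index below `n` depend only on history before `n`, so the default entries beyond
  -- it do not affect them.
  let Q : (ℕ → A) → ℕ → StrongDual ℝ X := fun h m => d (h m.unpair.1).2 m.unpair.2
  have : Inhabited A := ⟨⟨0, ⊥, by
    rw [Submodule.bot_coe]; exact (Set.countable_singleton _).isSeparable⟩⟩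
  let R : ℕ → (ℕ → A) → A → Prop := fun n h a =>
    (n = 0 → a.1 = x) ∧ (n ≠ 0 → a.1 ∈ D ∧ ∀ y ∈ D,
        F a.1 + ∑ i ∈ Finset.range n, c i * penalty (Q h) (a.1 - (h i).1) ≤
          F y + ∑ i ∈ Finset.range n, c i * penalty (Q h) (y - (h i).1) + (1 / 8) ^ n) ∧
      (∀ i, (h i).2.1 ≤ a.2.1) ∧
      ∀ i, ∃ p ∈ a.2.1, penalty (Q h) (a.1 - (h i).1) - (1 / 8) ^ n ≤
        p (a.1 - (h i).1) - rotund (Q h) p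
  have hR : ∀ n h, ∃ a, R n h a := by
    intro n h
    have h8 : (0 : ℝ) < (1 / 8) ^ n := by positivity
    obtain ⟨a, ha0, ha⟩ : ∃ a : X, (n = 0 → a = x) ∧ (n ≠ 0 → a ∈ D ∧ ∀ y ∈ D,
        F a + ∑ i ∈ Finset.range n, c i * penalty (Q h) (a - (h i).1) ≤
          F y + ∑ i ∈ Finset.range n, c i * penalty (Q h) (y - (h i).1) + (1 / 8) ^ n) := by
      by_cases hn : n = 0
      · exact ⟨x, fun _ => rfl, fun h => absurd hn h⟩
      set Φ : X → ℝ := fun y =>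
        F y + ∑ i ∈ Finset.range n, c i * penalty (Q h) (y - (h i).1)
      have hbdd : BddBelow (Φ '' D) := by
        refine ⟨b, ?_⟩
        rintro _ ⟨y, hy, rfl⟩
        have : 0 ≤ ∑ i ∈ Finset.range n, c i * penalty (Q h) (y - (h i).1) :=
          Finset.sum_nonneg fun i _ => mul_nonneg (hc i) (penalty_nonneg _ _)
        have := hb y hy
        simp only [Φ]
        linarith
      obtain ⟨_, ⟨a, haD, rfl⟩, ha⟩ := exists_lt_of_csInf_lt (hD.image Φ)
        (lt_add_of_pos_right (sInf (Φ '' D)) h8)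
      refine ⟨a, fun h => absurd h hn, fun _ => ⟨haD, fun y hy => ?_⟩⟩
      have := csInf_le hbdd (Set.mem_image_of_mem Φ hy)
      simp only [Φ] at this ha
      linarith
    choose p hp using fun i => exists_near_penalty (Q h) (a - (h i).1) h8
    refine ⟨⟨a, Submodule.span ℝ ((⋃ i, ((h i).2.1 : Set (StrongDual ℝ X))) ∪ Set.range p), ?_⟩,
      ha0, ha, fun i => ?_, fun i => ⟨p i, ?_, (hp i).le⟩⟩
    · exact ((TopologicalSpace.IsSeparable.iUnion fun i => (h i).2.2).union
        (Set.countable_range p).isSeparable).span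
    · exact fun v hv => Submodule.subset_span (Or.inl (Set.mem_iUnion.2 ⟨i, hv⟩))
    · exact Submodule.subset_span (Or.inr ⟨i, rfl⟩)
  obtain ⟨s, hs⟩ := exists_seq_of_history hR
  have htr : ∀ n, ∀ i < n, (if i < n then s i else default) = s i := fun n i hi => if_pos hi
  have hsum : ∀ n y, ∑ i ∈ Finset.range n,
      c i * penalty (Q fun i => if i < n then s i else default)
        (y - (if i < n then s i else default : A).1) =
      ∑ i ∈ Finset.range n,
        c i * penalty (Q fun i => if i < n then s i else default) (y - (s i).1) := fun n y =>
    Finset.sum_congr rfl fun i hi => by rw [htr n i (Finset.mem_range.1 hi)]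
  refine ⟨fun n => (s n).1, fun n => (s n).2.1, Q s,
    fun n => Q fun i => if i < n then s i else default, (hs 0).1 rfl,
    fun n hn => ((hs n).2.1 hn).1, fun n hn y hy => ?_, fun n i hi => ?_, ?_, ?_, ?_⟩
  · have := ((hs n).2.1 hn).2 y hy
    rwa [hsum, hsum] at this
  · have := (hs n).2.2.2 i
    simpa only [htr n i hi] using this
  · refine monotone_nat_of_le_succ fun n => ?_
    have := (hs (n + 1)).2.2.1 n
    simpa only [htr (n + 1) n n.lt_succ_self] using this
  · intro n
    refine (hd (s n).2).trans (closure_mono ?_)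
    rintro _ ⟨j, rfl⟩
    exact ⟨Nat.pair n j, by simp [Q]⟩
  · intro n m hm
    simp only [Q]
    rw [htr n _ ((Nat.unpair_left_le m).trans_lt hm)]

/-- Borwein–Preiss type minimization with penalties that are smooth at the minimizer. -/
lemma exists_penalized_minimizer [CompleteSpace X] (hX : IsReflexiveSpace X) {D : Set X}
    {F : X → ℝ} (hF : IsClosed {z : X × ℝ | z.1 ∈ D ∧ F z.1 ≤ z.2}) (hD : D.Nonempty) {b : ℝ}
    (hb : ∀ y ∈ D, b ≤ F y) {x : X} {ρ : ℝ} (hρ : ∀ y ∈ D, ‖y - x‖ ≤ ρ) {c : ℕ → ℝ}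
    (hc : ∀ i, 0 ≤ c i) (hcs : Summable c) {κ : ℝ} (hκ : 0 < κ)
    (hκc : ∀ n, n ≠ 0 → κ * (1 / 2) ^ n ≤ c n) :
    ∃ y ∈ D, ∃ (w : ℕ → X) (q P : ℕ → StrongDual ℝ X),
      w 0 = x ∧ (∀ z ∈ D, ∀ i, ‖z - w i‖ ≤ 2 * ρ) ∧
      (∀ z ∈ D, F y + ∑' i, c i * penalty q (y - w i) ≤
        F z + ∑' i, c i * penalty q (z - w i)) ∧
      ∀ i, penalty q (y - w i) ≤ P i (y - w i) - rotund q (P i) ∧ P i ∈ closure (Set.range q) := by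
  obtain ⟨w, S, q, qn, hw0, hwD, hmin, hnear, hS, hSq, hqn⟩ :=
    exists_penalized_sequence hD hb x hc
  have hρ0 : 0 ≤ ρ := hD.elim fun y hy => (norm_nonneg _).trans (hρ y hy)
  have hR : ∀ z ∈ D, ∀ i, ‖z - w i‖ ≤ 2 * ρ := fun z hz i => by
    by_cases hi : i = 0
    · rw [hi, hw0]; linarith [hρ z hz]
    · have := norm_sub_le_norm_sub_add_norm_sub z x (w i)
      rw [norm_sub_rev x] at this
      linarith [hρ z hz, hρ _ (hwD i hi)]
  have hpow : Tendsto (fun n : ℕ => (1 / 8 : ℝ) ^ n) atTop (𝓝 0) :=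
    tendsto_pow_atTop_nhds_zero_of_lt_one (by norm_num) (by norm_num)
  -- the sequence of approximate minimizers converges
  obtain ⟨K, hK0, hK⟩ : ∃ K : ℝ, 0 ≤ K ∧ ∀ n, n ≠ 0 → ‖w (n + 1) - w n‖ ≤ K * (1 / 2) ^ n := by
    set T := ∑' i, c i
    have hT : 0 ≤ T := tsum_nonneg hc
    -- Adding the near-minimality of `w n` and `w (n + 1)` bounds `c n * ‖w (n + 1) - w n‖ ^ 2` by
    -- `L * (1 / 8) ^ n`: two changes of directions and two tolerances, times `4` for the lower
    -- bound on the penalty. As `c n ≥ κ * (1 / 2) ^ n`, the steps decay like `(1 / 2) ^ n`.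
    set L := 32 * T * (2 * ρ) ^ 2 + 8 with hL
    have hL0 : 0 ≤ L := by positivity
    refine ⟨Real.sqrt (L / κ), Real.sqrt_nonneg _, fun n hn => ?_⟩
    have h8 : (0 : ℝ) < (1 / 8) ^ n := by positivity
    have hA := hmin (n + 1) n.succ_ne_zero (w n) (hwD n hn)
    have hB := hmin n hn (w (n + 1)) (hwD _ n.succ_ne_zero)
    rw [Finset.sum_range_succ, Finset.sum_range_succ, sub_self, penalty_zero, mul_zero, add_zero,
      pow_succ] at hA
    have hag : ∀ m < n, qn n m = qn (n + 1) m := fun m hm => by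
      rw [hqn n m hm, hqn (n + 1) m (hm.trans n.lt_succ_self)]
    have hsum : ∀ {q' q'' : ℕ → StrongDual ℝ X} {z : X}, (∀ m < n, q' m = q'' m) → z ∈ D →
        ∑ i ∈ Finset.range n, c i * penalty q' (z - w i) ≤
          ∑ i ∈ Finset.range n, c i * penalty q'' (z - w i) +
            T * (4 * (2 * ρ) ^ 2 * (1 / 8) ^ n) := by
      intro q' q'' z hq hz
      have h1 : (∑ i ∈ Finset.range n, c i) * (4 * (2 * ρ) ^ 2 * (1 / 8) ^ n) ≤
          T * (4 * (2 * ρ) ^ 2 * (1 / 8) ^ n) :=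
        mul_le_mul_of_nonneg_right (hcs.sum_le_tsum _ fun i _ => hc i) (by positivity)
      refine le_trans ?_ (add_le_add_right h1 _)
      rw [Finset.sum_mul, ← Finset.sum_add_distrib]
      refine Finset.sum_le_sum fun i _ => ?_
      rw [← mul_add]
      refine mul_le_mul_of_nonneg_left ((penalty_le_add_of_agree hq _).trans ?_) (hc i)
      have := hR z hz i
      gcongr
    have h1 := hsum hag (hwD _ n.succ_ne_zero)
    have h2 := hsum (fun m hm => (hag m hm).symm) (hwD n hn)
    have h3 := mul_le_mul_of_nonneg_left (quarter_le_penalty (qn (n + 1)) (w (n + 1) - w n)) (hc n)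
    have h4 := mul_le_mul_of_nonneg_right (hκc n hn)
      (show 0 ≤ ‖w (n + 1) - w n‖ ^ 2 / 4 by positivity)
    have h5 : κ * (1 / 2) ^ n * ‖w (n + 1) - w n‖ ^ 2 ≤ L * (1 / 8) ^ n := by
      rw [hL]; linarith
    have h6 : ((1 : ℝ) / 8) ^ n = (1 / 2) ^ n * ((1 / 2) ^ n) ^ 2 := by
      rw [← pow_mul, mul_comm n 2, pow_mul, ← mul_pow]; norm_num
    have h2n : (0 : ℝ) < (1 / 2) ^ n := by positivity
    have h7 : ‖w (n + 1) - w n‖ ^ 2 ≤ (L / κ) * ((1 / 2) ^ n) ^ 2 := by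
      rw [div_mul_eq_mul_div, le_div_iff₀ hκ]
      rw [h6] at h5
      refine le_of_mul_le_mul_left ?_ h2n
      linarith
    refine le_of_sq_le_sq ?_ (by positivity)
    rw [mul_pow, Real.sq_sqrt (by positivity)]
    exact h7
  obtain ⟨y, hy⟩ : ∃ y, Tendsto (fun n => w (n + 1)) atTop (𝓝 y) := by
    refine cauchySeq_tendsto_of_complete
      (cauchySeq_of_le_geometric (1 / 2) (K * (1 / 2)) (by norm_num) fun n => ?_)
    rw [dist_comm, dist_eq_norm]
    refine (hK (n + 1) n.succ_ne_zero).trans (le_of_eq ?_)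
    rw [pow_succ]; ring
  have hwy : Tendsto w atTop (𝓝 y) := (tendsto_add_atTop_iff_nat 1).1 hy
  have hne : ∀ᶠ n : ℕ in atTop, n ≠ 0 := eventually_ne_atTop 0
  -- the limit is a minimizer
  have hlim : ∀ z ∈ D, y ∈ D ∧
      F y ≤ F z + ∑' i, c i * penalty q (z - w i) + 0 - ∑' i, c i * penalty q (y - w i) := by
    intro z hz
    have h1 := tendsto_sum_penalty le_rfl hqn (tendsto_const_nhds (x := z))
      (Eventually.of_forall fun _ => hR z hz) hc hcs
    have h2 := tendsto_sum_penalty le_rfl hqn hwy (hne.mono fun n hn => hR _ (hwD n hn)) hc hcs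
    -- Near-minimality places these pairs in the epigraph of `F` over `D`; its closedness yields
    -- both `y ∈ D` and the limit inequality.
    have h3 := hwy.prodMk_nhds (((h1.const_add (F z)).add hpow).sub h2)
    refine hF.mem_of_tendsto h3 (hne.mono fun n hn => ⟨hwD n hn, ?_⟩)
    have := hmin n hn z hz
    simp only
    linarith
  have hyD : y ∈ D := hD.elim fun z hz => (hlim z hz).1
  -- near-maximizers converge weakly to maximizers
  have hP : ∀ i, ∃ p : StrongDual ℝ X,
      penalty q (y - w i) ≤ p (y - w i) - rotund q p ∧ p ∈ closure (Set.range q) := by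
    intro i
    have hch : ∀ n, ∃ p : StrongDual ℝ X, ‖p‖ ≤ 2 * (2 * ρ) + 2 ∧ (n ≠ 0 → i < n → p ∈ S n ∧
        penalty (qn n) (w n - w i) - (1 / 8) ^ n ≤ p (w n - w i) - rotund (qn n) p) := by
      intro n
      by_cases h : n ≠ 0 ∧ i < n
      · obtain ⟨p, hpS, hp⟩ := hnear n i h.2
        refine ⟨p, ?_, fun _ _ => ⟨hpS, hp⟩⟩
        have h1 := norm_le_of_near_penalty (q := qn n) (p := p) (z := w n - w i) (by
          have := penalty_nonneg (qn n) (w n - w i)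
          have : ((1 : ℝ) / 8) ^ n ≤ 1 := pow_le_one₀ (by norm_num) (by norm_num)
          linarith)
        linarith [hR _ (hwD n h.1) i]
      · exact ⟨0, by rw [norm_zero]; positivity, fun h1 h2 => absurd ⟨h1, h2⟩ h⟩
    choose pn hpn hpn' using hch
    obtain ⟨p, hp⟩ := exists_pointwise_limit hpn
    have hl : (hyperfilter ℕ : Filter ℕ) ≤ atTop := Nat.hyperfilter_le_atTop
    refine ⟨p, ?_, ?_⟩
    · refine penalty_attained_of_limit hl hqn ((hwy.mono_left hl).sub_const (w i)) hpn hp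
        (hpow.mono_left hl) ?_
      filter_upwards [hl hne, hl (eventually_gt_atTop i)] with n h1 h2
      exact (hpn' n h1 h2).2
    · have hmem := mem_of_pointwise_limit hX (Submodule.isClosed_topologicalClosure (⨆ n, S n))
        (Submodule.convex _) hp (by
          filter_upwards [hl hne, hl (eventually_gt_atTop i)] with n h1 h2
          exact Submodule.le_topologicalClosure _ (le_iSup S n (hpn' n h1 h2).1))
      rw [Submodule.topologicalClosure_coe] at hmem
      refine closure_minimal (fun v hv => ?_) isClosed_closure hmem
      obtain ⟨n, hn⟩ := (Submodule.mem_iSup_of_directed S hS.directed_le).1 hv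
      exact hSq n hn
  choose P hP using hP
  refine ⟨y, hyD, w, q, P, hw0, hR, fun z hz => ?_, hP⟩
  have := (hlim z hz).2
  linarith

/-! ### Fréchet subgradients at approximate minimizers. -/

/-- Weighted sums of penalties inherit Fréchet superdifferentiability. -/
lemma tsum_penalty_superdifferentiable {c : ℕ → ℝ} (hc : ∀ i, 0 ≤ c i) (hcs : Summable c)
    {q P : ℕ → StrongDual ℝ X} {z : ℕ → X} {R : ℝ} (hz : ∀ i, ‖z i‖ ≤ R)
    (hP : ∀ i, penalty q (z i) ≤ P i (z i) - rotund q (P i) ∧ P i ∈ closure (Set.range q))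
    {η : ℝ} (hη : 0 < η) :
    ∀ᶠ h in 𝓝 (0 : X),
      ∑' i, c i * (penalty q (z i + h) - penalty q (z i) - P i h) ≤ η * ‖h‖ := by
  have hPn : ∀ i, ‖P i‖ ≤ 2 * R := fun i =>
    (norm_le_of_eq_penalty ((penalty_nonneg _ _).trans (hP i).1)).trans (by linarith [hz i])
  have hlow : ∀ i h, 0 ≤ penalty q (z i + h) - penalty q (z i) - P i h := fun i h => by
    have := le_penalty q (P i) (z i + h)
    rw [map_add] at this
    linarith [(hP i).1]
  have hlim : Tendsto (fun h : X =>
      ∑' i, c i * ((penalty q (z i + h) - penalty q (z i) - P i h) / ‖h‖)) (𝓝 0)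
      (𝓝 (∑' _ : ℕ, 0)) := by
    -- For `‖h‖ < 1` the penalty increment contributes `2 * R + 4` to the quotient and `P i`
    -- contributes `2 * R`.
    refine tendsto_tsum_of_dominated_convergence (bound := fun i => c i * (4 * R + 4))
      (hcs.mul_right _) (fun i => ?_) ?_
    · rw [← mul_zero (c i)]
      refine Tendsto.const_mul _ ?_
      rw [Metric.tendsto_nhds]
      intro e he
      filter_upwards [penalty_superdifferentiable (hP i).1 (hP i).2 (half_pos he)] with h hh
      rw [dist_zero_right, Real.norm_of_nonneg (div_nonneg (hlow i h) (norm_nonneg h))]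
      refine lt_of_le_of_lt (div_le_of_le_mul₀ (norm_nonneg h) (half_pos he).le ?_) (half_lt_self he)
      linarith
    · filter_upwards [Metric.ball_mem_nhds (0 : X) one_pos] with h hh i
      rw [mem_ball_zero_iff] at hh
      have hR : 0 ≤ R := (norm_nonneg _).trans (hz i)
      rw [Real.norm_of_nonneg (mul_nonneg (hc i) (div_nonneg (hlow i h) (norm_nonneg h)))]
      refine mul_le_mul_of_nonneg_left
        (div_le_of_le_mul₀ (norm_nonneg h) (by positivity) ?_) (hc i)
      have h1 := penalty_sub_le q (z i + h) (z i)
      rw [add_sub_cancel_left] at h1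
      have h2 := (abs_le.1 ((P i).le_opNorm h)).1
      have h3 := mul_le_mul_of_nonneg_right (hPn i) (norm_nonneg h)
      have h4 : ‖z i + h‖ ≤ R + 1 := (norm_add_le _ _).trans (by linarith [hz i])
      have h5 : (2 * ‖z i + h‖ + 2) * ‖h‖ ≤ (2 * (R + 1) + 2) * ‖h‖ := by gcongr
      linarith
  rw [tsum_zero] at hlim
  filter_upwards [hlim.eventually (gt_mem_nhds hη)] with h hh
  have : ∑' i, c i * (penalty q (z i + h) - penalty q (z i) - P i h) =
      (∑' i, c i * ((penalty q (z i + h) - penalty q (z i) - P i h) / ‖h‖)) * ‖h‖ := by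
    rw [← tsum_mul_right]
    refine tsum_congr fun i => ?_
    by_cases h0 : h = 0
    · simp [h0]
    · rw [mul_assoc, div_mul_cancel₀ _ (norm_ne_zero_iff.2 h0)]
  rw [this]
  exact mul_le_mul_of_nonneg_right hh.le (norm_nonneg h)

/-- In a reflexive space, a function with closed epigraph has a Fréchet subgradient close to
`-J (y - x)` at an approximate minimizer `y` of its sum with `‖· - x‖² / 2`. -/
theorem exists_regular_subgradient [CompleteSpace X] (hX : IsReflexiveSpace X) {D : Set X}
    {F : X → ℝ} (hF : IsClosed {z : X × ℝ | z.1 ∈ D ∧ F z.1 ≤ z.2}) (hD : D.Nonempty) {b : ℝ}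
    (hb : ∀ y ∈ D, b ≤ F y) {x : X} {ρ : ℝ} (hρ : ∀ y ∈ D, ‖y - x‖ ≤ ρ) {δ : ℝ} (hδ : 0 < δ) :
    ∃ y ∈ D, ∃ p s : StrongDual ℝ X,
      ‖p‖ ≤ 2 * ‖y - x‖ ∧ ‖y - x‖ ^ 2 / 4 ≤ p (y - x) ∧ ‖s‖ ≤ δ ∧
      (∀ z ∈ D, F y ≤ F z + ‖z - x‖ ^ 2 / 2 - ‖y - x‖ ^ 2 / 4 + δ) ∧
      ∀ η > 0, ∀ᶠ h in 𝓝 (0 : X), y + h ∈ D → F y - (p + s) h - η * ‖h‖ ≤ F (y + h) := by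
  have hρ0 : 0 ≤ ρ := hD.elim fun y hy => (norm_nonneg _).trans (hρ y hy)
  -- The tail weights sum to `κ`, each `‖P i‖` is at most `4 * ρ` and each penalty on `D` at most `2
  -- * ρ ^ 2`. Hence both the tail functional and the tail penalty are at most `δ`.
  set κ := δ / (4 * ρ + 2 * ρ ^ 2 + 1)
  have hκ0 : 0 < κ := by positivity
  have hκ1 : κ * (4 * ρ + 2 * ρ ^ 2 + 1) = δ := div_mul_cancel₀ _ (by positivity)
  set c : ℕ → ℝ := fun i => if i = 0 then 1 else κ * (1 / 2) ^ i with hcdef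
  have hc0 : c 0 = 1 := rfl
  have hc1 : ∀ i, c (i + 1) = κ * (1 / 2) ^ (i + 1) := fun i => rfl
  have hc : ∀ i, 0 ≤ c i := fun i => by
    cases i with
    | zero => rw [hc0]; norm_num
    | succ i => rw [hc1]; positivity
  have hgeo : HasSum (fun i => c (i + 1)) κ := by
    have := (hasSum_geometric_of_lt_one (r := (1 / 2 : ℝ)) (by norm_num) (by norm_num)).mul_left
      (κ / 2)
    convert! this using 1
    · ext i; rw [hc1, pow_succ]; ring
    · norm_num
  have hcs : Summable c := (summable_nat_add_iff 1).1 hgeo.summable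
  obtain ⟨y, hyD, w, q, P, hw0, hR, hmin, hP⟩ := exists_penalized_minimizer hX hF hD hb hρ hc hcs
    hκ0 (fun n hn => by simp [hcdef, hn])
  have hPn : ∀ i, ‖P i‖ ≤ 2 * ‖y - w i‖ := fun i =>
    norm_le_of_eq_penalty ((penalty_nonneg _ _).trans (hP i).1)
  have hPn' : ∀ i, ‖P i‖ ≤ 4 * ρ := fun i => (hPn i).trans (by linarith [hR y hyD i])
  have hpen : ∀ z ∈ D, ∀ i, penalty q (z - w i) ≤ 2 * ρ ^ 2 := fun z hz i => by
    have h1 := penalty_le_half q (z - w i)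
    have h2 := pow_le_pow_left₀ (norm_nonneg _) (hR z hz i) 2
    nlinarith
  have hps : ∀ z ∈ D, Summable fun i => c i * penalty q (z - w i) := fun z hz =>
    Summable.of_nonneg_of_le (fun i => mul_nonneg (hc i) (penalty_nonneg _ _))
      (fun i => mul_le_mul_of_nonneg_left (hpen z hz i) (hc i)) (hcs.mul_right _)
  have hsn : ∀ i, ‖c (i + 1) • P (i + 1)‖ ≤ c (i + 1) * (4 * ρ) := fun i => by
    rw [norm_smul, Real.norm_of_nonneg (hc _)]
    exact mul_le_mul_of_nonneg_left (hPn' _) (hc _)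
  have hss : Summable fun i => c (i + 1) • P (i + 1) :=
    Summable.of_norm_bounded (hgeo.summable.mul_right _) hsn
  have hsplit : ∀ z ∈ D, ∑' i, c i * penalty q (z - w i) =
      penalty q (z - x) + ∑' i, c (i + 1) * penalty q (z - w (i + 1)) := fun z hz => by
    rw [(hps z hz).tsum_eq_zero_add, hc0, one_mul, hw0]
  -- The main penalty, centred at `w 0 = x` with weight `1`, gives `p`; all later ones give the
  -- small error `s`.
  refine ⟨y, hyD, P 0, ∑' i, c (i + 1) • P (i + 1), ?_, ?_, ?_, fun z hz => ?_, fun η hη => ?_⟩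
  · simpa [hw0] using hPn 0
  · have h1 := (hP 0).1
    rw [hw0] at h1
    linarith [quarter_le_penalty q (y - x), rotund_nonneg q (P 0)]
  · refine (tsum_of_norm_bounded (hgeo.mul_right (4 * ρ)) hsn).trans ?_
    rw [← hκ1]
    nlinarith [sq_nonneg ρ]
  · have h1 := hmin z hz
    rw [hsplit z hz, hsplit y hyD] at h1
    have h2 : 0 ≤ ∑' i, c (i + 1) * penalty q (y - w (i + 1)) :=
      tsum_nonneg fun i => mul_nonneg (hc _) (penalty_nonneg _ _)
    have h3 : ∑' i, c (i + 1) * penalty q (z - w (i + 1)) ≤ κ * (2 * ρ ^ 2) := by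
      rw [← hgeo.tsum_eq, ← tsum_mul_right]
      exact ((summable_nat_add_iff 1).2 (hps z hz)).tsum_le_tsum
        (fun i => mul_le_mul_of_nonneg_left (hpen z hz _) (hc _)) (hgeo.summable.mul_right _)
    have h4 : κ * (2 * ρ ^ 2) ≤ δ := by
      rw [← hκ1]
      nlinarith
    linarith [quarter_le_penalty q (y - x), penalty_le_half q (z - x)]
  · filter_upwards [tsum_penalty_superdifferentiable hc hcs (hR y hyD) hP hη] with h hh hD'
    have h1 := hmin _ hD'
    have hPs : Summable fun i => c i * P i h := by
      refine Summable.of_norm_bounded (hcs.mul_right (4 * ρ * ‖h‖)) fun i => ?_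
      rw [norm_mul, Real.norm_of_nonneg (hc i)]
      refine mul_le_mul_of_nonneg_left (((P i).le_opNorm h).trans ?_) (hc i)
      exact mul_le_mul_of_nonneg_right (hPn' i) (norm_nonneg h)
    have h2 : ∑' i, c i * P i h = (P 0 + ∑' i, c (i + 1) • P (i + 1)) h := by
      rw [hPs.tsum_eq_zero_add, hc0, one_mul, add_apply]
      congr 1
      have := (ContinuousLinearMap.apply ℝ ℝ h).map_tsum hss
      simpa using this.symm
    have h3 : ∑' i, c i * (penalty q (y - w i + h) - penalty q (y - w i) - P i h) =
        ∑' i, c i * penalty q (y + h - w i) - ∑' i, c i * penalty q (y - w i)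
          - ∑' i, c i * P i h := by
      rw [← (hps _ hD').tsum_sub (hps y hyD), ← ((hps _ hD').sub (hps y hyD)).tsum_sub hPs]
      refine tsum_congr fun i => ?_
      rw [sub_add_eq_add_sub]
      ring
    rw [h3, h2] at hh
    linarith

/-! ### Regular and limiting subgradients, and their global form for convex functions. -/

lemma exists_coe_eq {a : EReal} (ht : a ≠ ⊤) (hb : a ≠ ⊥) : ∃ r : ℝ, a = r :=
  ⟨a.toReal, (EReal.coe_toReal ht hb).symm⟩

lemma mem_epsRegularSubdiff_of_eventually {f : X → EReal} {x : X} {xs : StrongDual ℝ X} {ε : ℝ}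
    (ht : f x ≠ ⊤) (hb : f x ≠ ⊥)
    (h : ∀ η > 0, ∀ᶠ y in 𝓝 x,
      f x + ((xs (y - x) - (ε + η) * ‖y - x‖ : ℝ) : EReal) ≤ f y) :
    xs ∈ epsRegularSubdiff ε f x := by
  refine ⟨ht, le_of_forall_lt fun c hc => ?_⟩
  obtain ⟨r, hcr, hr⟩ := EReal.lt_iff_exists_real_btwn.1 hc
  rw [EReal.coe_lt_coe_iff] at hr
  refine hcr.trans_le (le_liminf_of_le (by isBoundedDefault) ?_)
  have h1 := (h (-ε - r) (by linarith)).filter_mono (nhdsWithin_le_nhds (s := {x}ᶜ))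
  filter_upwards [h1, self_mem_nhdsWithin] with y hy hyx
  have hpos : 0 < ‖y - x‖ := norm_pos_iff.2 (sub_ne_zero.2 hyx)
  rw [EReal.le_div_iff_mul_le (by exact_mod_cast hpos) (EReal.coe_ne_top _)]
  obtain ⟨a, ha⟩ := exists_coe_eq ht hb
  rw [ha] at hy ⊢
  by_cases hyt : f y = ⊤
  · rw [hyt, EReal.top_sub_coe, EReal.top_sub_coe]
    exact le_top
  have hyb : f y ≠ ⊥ := fun hbot => by
    rw [hbot, ← EReal.coe_add] at hy
    exact EReal.coe_ne_bot _ (le_bot_iff.1 hy)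
  obtain ⟨d, hd⟩ := exists_coe_eq hyt hyb
  rw [hd] at hy ⊢
  norm_cast at hy ⊢
  linarith

lemma eventually_of_mem_epsRegularSubdiff {f : X → EReal} {x : X} {xs : StrongDual ℝ X} {ε : ℝ}
    (hf : NeverBot f) (h : xs ∈ epsRegularSubdiff ε f x) {η : ℝ} (hη : 0 < η) :
    ∀ᶠ y in 𝓝[≠] x, f x + ((xs (y - x) - (ε + η) * ‖y - x‖ : ℝ) : EReal) ≤ f y := by
  have hlt : ((-(ε + η) : ℝ) : EReal) < ((-ε : ℝ) : EReal) := by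
    rw [EReal.coe_lt_coe_iff]; linarith
  filter_upwards [eventually_lt_of_lt_liminf (hlt.trans_le h.2), self_mem_nhdsWithin] with y hy hyx
  have hpos : 0 < ‖y - x‖ := norm_pos_iff.2 (sub_ne_zero.2 hyx)
  have hy := hy.le
  rw [EReal.le_div_iff_mul_le (by exact_mod_cast hpos) (EReal.coe_ne_top _)] at hy
  obtain ⟨a, ha⟩ := exists_coe_eq h.1 (hf x)
  by_cases hyt : f y = ⊤
  · rw [hyt]; exact le_top
  obtain ⟨d, hd⟩ := exists_coe_eq hyt (hf y)
  rw [ha, hd] at hy ⊢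
  norm_cast at hy ⊢
  linarith

/-- Regular subgradient inequalities of convex functions are global. -/
lemma IsConvex.le_of_mem_epsRegularSubdiff {g : X → EReal} (hg : IsConvex g) (hb : NeverBot g)
    {x : X} {xs : StrongDual ℝ X} {ε : ℝ} (h : xs ∈ epsRegularSubdiff ε g x) (y : X) :
    g x + ((xs (y - x) - ε * ‖y - x‖ : ℝ) : EReal) ≤ g y := by
  obtain ⟨a, ha⟩ := exists_coe_eq h.1 (hb x)
  by_cases hyt : g y = ⊤
  · rw [hyt]; exact le_top
  obtain ⟨d, hd⟩ := exists_coe_eq hyt (hb y)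
  by_cases hyx : y = x
  · subst hyx; simp
  have hpos : 0 < ‖y - x‖ := norm_pos_iff.2 (sub_ne_zero.2 hyx)
  rw [ha, hd, ← EReal.coe_add, EReal.coe_le_coe_iff]
  refine le_of_forall_pos_le_add fun η hη => ?_
  have hev := eventually_of_mem_epsRegularSubdiff hb h (div_pos hη hpos)
  have htend : Tendsto (fun t : ℝ => x + t • (y - x)) (𝓝[>] 0) (𝓝[≠] x) := by
    refine tendsto_nhdsWithin_iff.2 ⟨?_, ?_⟩
    · have : Continuous fun t : ℝ => x + t • (y - x) := by fun_prop
      have := this.tendsto 0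
      rw [zero_smul, add_zero] at this
      exact this.mono_left nhdsWithin_le_nhds
    · filter_upwards [self_mem_nhdsWithin] with t ht
      simp [sub_eq_zero, hyx, (Set.mem_Ioi.1 ht).ne']
  obtain ⟨t, ht1, ht0, ht⟩ := ((htend.eventually hev).and
    (Ioo_mem_nhdsGT (show (0 : ℝ) < 1 by norm_num))).exists
  have hconv := hg x y (1 - t) t (by linarith) ht0 (by ring)
  have hpt : (1 - t) • x + t • y = x + t • (y - x) := by module
  rw [hpt] at hconv
  have := ht1.trans hconv
  rw [add_sub_cancel_left, norm_smul, Real.norm_of_nonneg ht0.le, map_smul, ha, hd] at this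
  norm_cast at this
  rw [smul_eq_mul] at this
  have h2 : η / ‖y - x‖ * (t * ‖y - x‖) = t * η := by field_simp
  have h3 : t * (a + (xs (y - x) - ε * ‖y - x‖)) ≤ t * (d + η) := by nlinarith
  exact le_of_mul_le_mul_left h3 ht0

/-- Limiting subgradients of convex functions are subgradients of convex analysis. -/
lemma IsConvex.le_of_mem_limitingSubdiff [CompleteSpace X] {g : X → EReal} (hg : IsConvex g)
    (hb : NeverBot g) {x : X} {xs : StrongDual ℝ X} (h : xs ∈ limitingSubdiff g x) (y : X) :
    g x + ((xs (y - x) : ℝ) : EReal) ≤ g y := by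
  obtain ⟨hx, ε, xk, xsk, -, hε, hxk, hgk, hxsk, hmem⟩ := h
  by_cases hyt : g y = ⊤
  · rw [hyt]; exact le_top
  obtain ⟨d, hd⟩ := exists_coe_eq hyt (hb y)
  -- Weak-star convergent sequences are bounded, which is what makes the pairing with the
  -- norm-convergent `xk k` pass to the limit.
  obtain ⟨C, hC⟩ := banach_steinhaus (g := xsk) fun v => by
    obtain ⟨C, hC⟩ := (hxsk v).norm.bddAbove_range
    exact ⟨C, fun k => hC ⟨k, rfl⟩⟩
  have hreal := (EReal.tendsto_toReal hx (hb x)).comp hgk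
  have h1 : Tendsto (fun k => xsk k (y - xk k)) atTop (𝓝 (xs (y - x))) := by
    have h0 : Tendsto (fun k => xsk k (x - xk k)) atTop (𝓝 0) := by
      refine squeeze_zero_norm (a := fun k => C * ‖x - xk k‖) (fun k => ?_) ?_
      · exact ((xsk k).le_opNorm _).trans (mul_le_mul_of_nonneg_right (hC k) (norm_nonneg _))
      · simpa using ((hxk.const_sub x).norm.const_mul C)
    simpa [← map_add] using (hxsk (y - x)).add h0
  have h2 := hreal.add (h1.sub (hε.mul (hxk.const_sub y).norm))
  rw [zero_mul, sub_zero] at h2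
  have h3 := le_of_tendsto' h2 (b := d) fun k => by
    have := hg.le_of_mem_epsRegularSubdiff hb (hmem k) y
    rw [hd, ← EReal.coe_toReal (hmem k).1 (hb _)] at this
    exact_mod_cast this
  rw [hd, ← EReal.coe_toReal hx (hb x)]
  exact_mod_cast h3

lemma epsRegularSubdiff_mono {ε ε' : ℝ} (h : ε ≤ ε') (f : X → EReal) (x : X) :
    epsRegularSubdiff ε f x ⊆ epsRegularSubdiff ε' f x := fun xs hxs =>
  ⟨hxs.1, le_trans (by rw [EReal.coe_le_coe_iff]; linarith) hxs.2⟩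

lemma mem_limitingSubdiff_of_tendsto {f : X → EReal} {x : X} (hx : f x ≠ ⊤) {xs : StrongDual ℝ X}
    {xk : ℕ → X} {xsk : ℕ → StrongDual ℝ X} (hxk : Tendsto xk atTop (𝓝 x))
    (hf : Tendsto (fun k => f (xk k)) atTop (𝓝 (f x)))
    (hxsk : ∀ v : X, Tendsto (fun k => xsk k v) atTop (𝓝 (xs v)))
    (h : ∀ k, xsk k ∈ epsRegularSubdiff 0 f (xk k)) : xs ∈ limitingSubdiff f x :=
  ⟨hx, fun k => 1 / ((k : ℝ) + 1), xk, xsk, fun k => by positivity,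
    tendsto_one_div_add_atTop_nhds_zero_nat, hxk, hf, hxsk,
    fun k => epsRegularSubdiff_mono (by positivity) f _ (h k)⟩

lemma epsRegularSubdiff_subset_limitingSubdiff (f : X → EReal) (x : X) :
    epsRegularSubdiff 0 f x ⊆ limitingSubdiff f x := fun _ h =>
  mem_limitingSubdiff_of_tendsto h.1 tendsto_const_nhds tendsto_const_nhds
    (fun _ => tendsto_const_nhds) fun _ => h

lemma mem_limitingSubdiff_of_le {f : X → EReal} {x : X} {xs : StrongDual ℝ X}
    (ht : f x ≠ ⊤) (hb : f x ≠ ⊥) (h : ∀ y, f x + ((xs (y - x) : ℝ) : EReal) ≤ f y) :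
    xs ∈ limitingSubdiff f x := by
  refine epsRegularSubdiff_subset_limitingSubdiff f x
    (mem_epsRegularSubdiff_of_eventually ht hb fun η hη => Eventually.of_forall fun y => ?_)
  refine le_trans ?_ (h y)
  gcongr
  have := mul_nonneg hη.le (norm_nonneg (y - x))
  linarith

/-! ### The duality mapping and the sum rule for strongly convex functions. -/

lemma exists_mem_dualityMap (x : X) : ∃ j, j ∈ dualityMap x := by
  obtain ⟨g, hg, hgx⟩ := exists_dual_vector'' ℝ x
  refine ⟨‖x‖ • g, ?_⟩
  have h1 : (‖x‖ • g) x = ‖x‖ ^ 2 := by simp [hgx, sq]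
  have h2 : ‖‖x‖ • g‖ ≤ ‖x‖ := by
    rw [norm_smul, norm_norm]
    nlinarith [norm_nonneg x]
  refine ⟨h1, le_antisymm ?_ (pow_le_pow_left₀ (norm_nonneg _) h2 2)⟩
  have h3 := (le_abs_self _).trans ((‖x‖ • g).le_opNorm x)
  rw [h1] at h3
  by_cases hx : ‖x‖ = 0
  · rw [hx, zero_pow two_ne_zero]; positivity
  · have : 0 < ‖x‖ := lt_of_le_of_ne (norm_nonneg _) (Ne.symm hx)
    have : ‖x‖ ≤ ‖‖x‖ • g‖ := le_of_mul_le_mul_right (by rwa [← sq]) this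
    exact pow_le_pow_left₀ (norm_nonneg _) this 2

/-- The expression dominates `(‖u‖ - ‖x‖) ^ 2`, so the inequalities in (ii) contain ordinary
subgradient inequalities. -/
lemma quadratic_nonneg {u x : X} {j : StrongDual ℝ X} (hj : j ∈ dualityMap u) :
    0 ≤ ‖u‖ ^ 2 - 2 * j x + ‖x‖ ^ 2 := by
  have h1 : ‖j‖ = ‖u‖ := (sq_eq_sq₀ (norm_nonneg _) (norm_nonneg _)).1 hj.2.symm
  have h2 := (le_abs_self _).trans (j.le_opNorm x)
  rw [h1] at h2
  nlinarith [sq_nonneg (‖u‖ - ‖x‖)]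

/-- Subgradients of `‖·‖² / 2` belong to the duality mapping. -/
lemma mem_dualityMap_of_subgradient {u : X} {j : StrongDual ℝ X}
    (h : ∀ x, ‖u‖ ^ 2 / 2 + j (x - u) ≤ ‖x‖ ^ 2 / 2) : j ∈ dualityMap u := by
  have hju : j u = ‖u‖ ^ 2 := by
    -- The inequality along the line `t • u` is a quadratic in `t` that is never negative, and its
    -- discriminant is `(j u - ‖u‖ ^ 2) ^ 2`.
    have hd : discrim (‖u‖ ^ 2 / 2) (-j u) (j u - ‖u‖ ^ 2 / 2) ≤ 0 :=
      discrim_le_zero fun t => by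
        have := h (t • u)
        rw [map_sub, map_smul, norm_smul, mul_pow, Real.norm_eq_abs, sq_abs, smul_eq_mul] at this
        linarith
    unfold discrim at hd
    have : (j u - ‖u‖ ^ 2) ^ 2 ≤ 0 := by linarith
    have := pow_eq_zero_iff (two_ne_zero) |>.1 (le_antisymm this (sq_nonneg _))
    linarith
  have hle : ‖j‖ ≤ ‖u‖ := by
    refine j.opNorm_le_bound (norm_nonneg u) fun x => ?_
    have hd : discrim (‖x‖ ^ 2 / 2) (-j x) (‖u‖ ^ 2 / 2) ≤ 0 :=
      discrim_le_zero fun t => by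
        have := h (t • x)
        rw [map_sub, map_smul, norm_smul, mul_pow, Real.norm_eq_abs, sq_abs, smul_eq_mul,
          hju] at this
        linarith
    unfold discrim at hd
    refine abs_le_of_sq_le_sq ?_ (by positivity)
    linarith
  refine ⟨hju, le_antisymm ?_ (pow_le_pow_left₀ (norm_nonneg _) hle 2)⟩
  have h3 := (le_abs_self _).trans (j.le_opNorm u)
  rw [hju] at h3
  by_cases hx : ‖u‖ = 0
  · rw [hx, zero_pow two_ne_zero]; positivity
  · have : 0 < ‖u‖ := lt_of_le_of_ne (norm_nonneg _) (Ne.symm hx)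
    have : ‖u‖ ≤ ‖j‖ := le_of_mul_le_mul_right (by rwa [← sq]) this
    exact pow_le_pow_left₀ (norm_nonneg _) this 2

/-- The sum rule for a strongly convex function, written as the sum of a convex function and a
multiple of `‖·‖² / 2`. -/
lemma IsStronglyConvex.exists_dualityMap {σ : ℝ} (hσ : 0 < σ) {g : X → EReal}
    (hg : IsStronglyConvex σ g) {u : X} {us : StrongDual ℝ X} {a : ℝ} (hu : g u = a)
    (h : ∀ x, g u + ((us (x - u) : ℝ) : EReal) ≤ g x) :
    ∃ j ∈ dualityMap u, ∀ x,
      g u + ((us (x - u) + σ / 2 * (‖u‖ ^ 2 - 2 * j x + ‖x‖ ^ 2) : ℝ) : EReal) ≤ g x := by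
  set k : X → ℝ := fun x => σ / 2 * ‖x‖ ^ 2 with hk
  have hkc : Continuous k := by fun_prop
  have hconc : ConcaveOn ℝ Set.univ fun x => a - us u - k x := by
    have h1 : ConvexOn ℝ Set.univ fun x : X => ‖x‖ ^ 2 :=
      (convexOn_norm convex_univ).pow (fun _ _ => norm_nonneg _) 2
    have h2 : ConvexOn ℝ Set.univ k := h1.smul (show (0 : ℝ) ≤ σ / 2 by positivity)
    exact (concaveOn_const (a - us u) convex_univ).sub h2
  have hBc : Convex ℝ {z : X × ℝ | z.2 < a - us u - k z.1} := by
    simpa using hconc.convex_strict_hypograph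
  have hBo : IsOpen {z : X × ℝ | z.2 < a - us u - k z.1} :=
    isOpen_lt continuous_snd (by fun_prop)
  have hA : Convex ℝ {z : X × ℝ | g z.1 ≤ ((z.2 + us z.1 + k z.1 : ℝ) : EReal)} := by
    rw [convex_iff_forall_pos]
    rintro ⟨x, s⟩ hx ⟨y, t⟩ hy α β hα hβ hαβ
    simp only [Set.mem_ofPred_eq, Prod.smul_mk, Prod.mk_add_mk] at hx hy ⊢
    have hsub : ∀ {z : X} {r : ℝ}, g z ≤ ((r + k z : ℝ) : EReal) ↔
        g z - ((k z : ℝ) : EReal) ≤ r := fun {z r} => by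
      rw [EReal.sub_le_iff_le_add (Or.inl (EReal.coe_ne_bot _)) (Or.inl (EReal.coe_ne_top _)),
        EReal.coe_add]
    rw [hsub] at hx hy ⊢
    refine (hg x y α β hα hβ hαβ).trans ?_
    have hα' : (0 : EReal) ≤ (α : EReal) := by exact_mod_cast hα.le
    have hβ' : (0 : EReal) ≤ (β : EReal) := by exact_mod_cast hβ.le
    refine (add_le_add (mul_le_mul_of_nonneg_left hx hα')
      (mul_le_mul_of_nonneg_left hy hβ')).trans (le_of_eq ?_)
    norm_cast
    simp only [map_add, map_smul, smul_eq_mul]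
    ring
  -- The function `g - us` is minimal at `u` with value `a - us u`, so the epigraph of `g - us - k`
  -- lies above the graph of `a - us u - k`. Continuity of `k` makes the strict hypograph open, as
  -- separation requires.
  have hdisj : Disjoint {z : X × ℝ | z.2 < a - us u - k z.1}
      {z : X × ℝ | g z.1 ≤ ((z.2 + us z.1 + k z.1 : ℝ) : EReal)} := by
    rw [Set.disjoint_left]
    rintro ⟨x, t⟩ h1 h2
    have h3 := (h x).trans h2
    rw [hu] at h3
    norm_cast at h3
    simp only [Set.mem_ofPred_eq, map_sub] at h1 h3
    linarith
  obtain ⟨f, s, hf1, hf2⟩ := geometric_hahn_banach_open hBc hBo hA hdisj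
  have hf : ∀ x t, f (x, t) = f (x, 0) + t * f (0, 1) := fun x t => by
    rw [← smul_eq_mul, ← map_smul, ← map_add]
    simp
  have hs : s ≤ f (u, 0) + (a - us u - k u) * f (0, 1) := by
    rw [← hf]
    refine hf2 _ ?_
    simp only [Set.mem_ofPred_eq, hu, EReal.coe_le_coe_iff]
    linarith
  have hβ : 0 < f (0, 1) := by
    have h1 := hf1 (u, a - us u - k u - 1) (by simp)
    rw [hf] at h1
    linarith
  have hs' : ∀ x, f (x, 0) + (a - us u - k x) * f (0, 1) ≤ s := fun x => by
    refine le_of_forall_pos_le_add fun e he => ?_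
    have h1 := hf1 (x, a - us u - k x - e / f (0, 1)) (by simp; positivity)
    rw [hf, sub_mul, div_mul_cancel₀ _ hβ.ne'] at h1
    linarith
  -- The separating hyperplane is not vertical, and `l` is minus its slope: a subgradient of `k` at
  -- `u`, with `us - l` one of `g - k`.
  set l : StrongDual ℝ X := (f (0, 1))⁻¹ • f.comp (ContinuousLinearMap.inl ℝ X ℝ) with hl
  have hlx : ∀ x, f (x, 0) = l x * f (0, 1) := fun x => by
    simp only [hl, smul_apply, ContinuousLinearMap.comp_apply, ContinuousLinearMap.inl_apply,
      smul_eq_mul]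
    field_simp
  have hk1 : ∀ x, l x - k x ≤ l u - k u := fun x => by
    have := (hs' x).trans hs
    rw [hlx, hlx, ← add_mul, ← add_mul] at this
    have := le_of_mul_le_mul_right this hβ
    linarith
  have hj : σ⁻¹ • l ∈ dualityMap u := mem_dualityMap_of_subgradient fun x => by
    have := hk1 x
    simp only [hk] at this
    rw [smul_apply, smul_eq_mul, map_sub]
    rw [← sub_nonneg] at this ⊢
    have h2 := mul_nonneg (inv_nonneg.2 hσ.le) this
    refine h2.trans (le_of_eq ?_)
    field_simp
    ring
  refine ⟨σ⁻¹ • l, hj, fun x => ?_⟩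
  rcases eq_or_ne (g x) ⊤ with hx | hx
  · rw [hx]; exact le_top
  obtain ⟨d, hd⟩ := exists_coe_eq hx fun hbot => by
    have := h x
    rw [hbot, hu, ← EReal.coe_add] at this
    exact EReal.coe_ne_bot _ (le_bot_iff.1 this)
  have h1 := (hs' u).trans (hf2 (x, d - us x - k x) (by
    simp only [Set.mem_ofPred_eq, hd, EReal.coe_le_coe_iff]
    linarith))
  rw [hf x, hlx, hlx, ← add_mul, ← add_mul] at h1
  have h1 := le_of_mul_le_mul_right h1 hβ
  have hju := hj.1
  rw [smul_apply, smul_eq_mul, inv_mul_eq_iff_eq_mul₀ hσ.ne'] at hju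
  rw [hu, hd, ← EReal.coe_add, EReal.coe_le_coe_iff, smul_apply, smul_eq_mul, map_sub]
  have h3 : σ / 2 * (‖u‖ ^ 2 - 2 * (σ⁻¹ * l x) + ‖x‖ ^ 2) = k u - l x + k x := by
    simp only [hk]; field_simp
  rw [h3]
  simp only [hk] at h1 ⊢
  linarith

/-! ### From variational convexity to subgradient inequalities. -/

theorem IsVariationallyConvex.hasSubgradientInequalities [CompleteSpace X] {σ : ℝ} (hσ : 0 ≤ σ)
    {f : X → EReal} {x₀ : X} {xs₀ : StrongDual ℝ X} (h : IsVariationallyConvex σ f x₀ xs₀) :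
    HasSubgradientInequalities σ f x₀ xs₀ := by
  obtain ⟨-, U, V, g, ε, hUV, hε, hgb, -, hgc, hgs, hle, heq, hval⟩ := h
  refine ⟨U, V, ε, hUV, hε, fun u us hu => ?_⟩
  rw [heq] at hu
  have hfu : f u = g u := hval _ hu
  have hmem : us ∈ limitingSubdiff g u := hu.2
  have hsub := hgc.le_of_mem_limitingSubdiff hgb hmem
  obtain ⟨a, ha⟩ := exists_coe_eq hmem.1 (hgb u)
  rcases hσ.eq_or_lt with rfl | hσ
  · obtain ⟨j, hj⟩ := exists_mem_dualityMap u
    refine ⟨j, hj, fun x hx => ?_⟩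
    rw [zero_div, zero_mul, add_zero, hfu]
    exact (hsub x).trans (hle x hx)
  · obtain ⟨j, hj, hjx⟩ := (hgs hσ).exists_dualityMap hσ ha hsub
    exact ⟨j, hj, fun x hx => hfu ▸ (hjx x).trans (hle x hx)⟩

/-! ### Suprema of quadratic functions with common curvature `σ`. -/

section SupQuadratics

variable {ι : Type*} {σ : ℝ} {α : ι → ℝ} {l : ι → StrongDual ℝ X} {g : X → EReal}

lemma neverBot_of_iSup [Nonempty ι]
    (hg : ∀ x, g x = ⨆ i, ((α i + l i x + σ / 2 * ‖x‖ ^ 2 : ℝ) : EReal)) : NeverBot g := by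
  intro x hx
  rw [hg, iSup_eq_bot] at hx
  exact EReal.coe_ne_bot _ (hx (Classical.arbitrary ι))

lemma lowerSemicontinuous_of_iSup
    (hg : ∀ x, g x = ⨆ i, ((α i + l i x + σ / 2 * ‖x‖ ^ 2 : ℝ) : EReal)) :
    LowerSemicontinuous g := by
  rw [funext hg]
  refine lowerSemicontinuous_iSup fun i => Continuous.lowerSemicontinuous ?_
  exact continuous_coe_real_ereal.comp (by fun_prop)

lemma isStronglyConvex_of_iSup
    (hg : ∀ x, g x = ⨆ i, ((α i + l i x + σ / 2 * ‖x‖ ^ 2 : ℝ) : EReal)) :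
    IsStronglyConvex σ g := by
  intro x y a b ha hb hab
  have hle : ∀ i z, ((α i + l i z : ℝ) : EReal) ≤ g z - ((σ / 2 * ‖z‖ ^ 2 : ℝ) : EReal) :=
    fun i z => by
      rw [EReal.le_sub_iff_add_le (Or.inl (EReal.coe_ne_bot _)) (Or.inl (EReal.coe_ne_top _)), hg,
        ← EReal.coe_add]
      exact le_iSup (fun i => ((α i + l i z + σ / 2 * ‖z‖ ^ 2 : ℝ) : EReal)) i
  have ha' : (0 : EReal) ≤ (a : EReal) := by exact_mod_cast ha.le
  have hb' : (0 : EReal) ≤ (b : EReal) := by exact_mod_cast hb.le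
  show g _ - _ ≤ _
  rw [EReal.sub_le_iff_le_add (Or.inl (EReal.coe_ne_bot _)) (Or.inl (EReal.coe_ne_top _)), hg]
  refine iSup_le fun i => ?_
  rw [EReal.coe_add]
  gcongr
  refine le_trans (le_of_eq ?_) (add_le_add (mul_le_mul_of_nonneg_left (hle i x) ha')
    (mul_le_mul_of_nonneg_left (hle i y) hb'))
  norm_cast
  simp only [map_add, map_smul, smul_eq_mul]
  linear_combination (-α i) * hab

lemma isConvex_of_iSup (hσ : 0 ≤ σ)
    (hg : ∀ x, g x = ⨆ i, ((α i + l i x + σ / 2 * ‖x‖ ^ 2 : ℝ) : EReal)) : IsConvex g := by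
  intro x y a b ha hb hab
  have hle : ∀ i z, ((α i + l i z + σ / 2 * ‖z‖ ^ 2 : ℝ) : EReal) ≤ g z := fun i z => by
    rw [hg]
    exact le_iSup (fun i => ((α i + l i z + σ / 2 * ‖z‖ ^ 2 : ℝ) : EReal)) i
  have ha' : (0 : EReal) ≤ (a : EReal) := by exact_mod_cast ha.le
  have hb' : (0 : EReal) ≤ (b : EReal) := by exact_mod_cast hb.le
  rw [hg (a • x + b • y)]
  refine iSup_le fun i => ?_
  refine le_trans ?_ (add_le_add (mul_le_mul_of_nonneg_left (hle i x) ha')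
    (mul_le_mul_of_nonneg_left (hle i y) hb'))
  norm_cast
  simp only [map_add, map_smul, smul_eq_mul]
  have h1 : ConvexOn ℝ Set.univ fun x : X => ‖x‖ ^ 2 :=
    (convexOn_norm convex_univ).pow (fun _ _ => norm_nonneg _) 2
  have h2 := h1.2 (Set.mem_univ x) (Set.mem_univ y) ha.le hb.le hab
  simp only [smul_eq_mul] at h2
  have h3 := mul_le_mul_of_nonneg_left h2 (show (0 : ℝ) ≤ σ / 2 by positivity)
  have h4 : α i = a * α i + b * α i := by rw [← add_mul, hab, one_mul]
  linarith

end SupQuadratics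

/-! ### Localization of subgradients and the converse implication. -/

/-- Localized form of `exists_regular_subgradient` for extended-real-valued functions. -/
lemma exists_regular_subgradient_near [CompleteSpace X] (hX : IsReflexiveSpace X) {φ : X → EReal}
    (hφb : NeverBot φ) (hφ : LowerSemicontinuous φ) {x₀ : X} {r : ℝ} (hr : 0 < r) {b : ℝ}
    (hb : ∀ y ∈ Metric.closedBall x₀ r, (b : EReal) ≤ φ y) (hx₀ : φ x₀ ≠ ⊤) {x : X}
    (hx : x ∈ Metric.closedBall x₀ r) (xs : StrongDual ℝ X) {δ : ℝ} (hδ : 0 < δ) :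
    ∃ y ∈ Metric.closedBall x₀ r, φ y ≠ ⊤ ∧ ∃ p s : StrongDual ℝ X,
      ‖p‖ ≤ 2 * ‖y - x‖ ∧ ‖y - x‖ ^ 2 / 4 ≤ p (y - x) ∧ ‖s‖ ≤ δ ∧
      (φ y).toReal - xs y ≤
        (φ x₀).toReal - xs x₀ + ‖x₀ - x‖ ^ 2 / 2 - ‖y - x‖ ^ 2 / 4 + δ ∧
      (‖y - x₀‖ < r → xs - (p + s) ∈ epsRegularSubdiff 0 φ y) := by
  set D : Set X := {y ∈ Metric.closedBall x₀ r | φ y ≠ ⊤}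
  have hreal : ∀ y ∈ D, φ y = ((φ y).toReal : EReal) := fun y hy =>
    (EReal.coe_toReal hy.2 (hφb y)).symm
  have hx₀D : x₀ ∈ D := ⟨Metric.mem_closedBall_self hr.le, hx₀⟩
  have hclosed : IsClosed {z : X × ℝ | z.1 ∈ D ∧ (φ z.1).toReal - xs z.1 ≤ z.2} := by
    have heq : {z : X × ℝ | z.1 ∈ D ∧ (φ z.1).toReal - xs z.1 ≤ z.2} =
        {z : X × ℝ | z.1 ∈ Metric.closedBall x₀ r} ∩
          (fun z : X × ℝ => (z.1, ((z.2 + xs z.1 : ℝ) : EReal))) ⁻¹'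
            {p : X × EReal | φ p.1 ≤ p.2} := by
      ext ⟨y, t⟩
      simp only [Set.mem_ofPred_eq, Set.mem_inter_iff, Set.mem_preimage]
      constructor
      · rintro ⟨hy, hle⟩
        refine ⟨hy.1, ?_⟩
        rw [hreal y hy, EReal.coe_le_coe_iff]
        linarith
      · rintro ⟨hy, hle⟩
        have hyD : y ∈ D := ⟨hy, fun h => by
          rw [h] at hle
          exact EReal.coe_ne_top _ (top_le_iff.1 hle)⟩
        rw [hreal y hyD, EReal.coe_le_coe_iff] at hle
        exact ⟨hyD, by linarith⟩
    rw [heq]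
    refine (Metric.isClosed_closedBall.preimage continuous_fst).inter
      (hφ.isClosed_epigraph.preimage ?_)
    exact continuous_fst.prodMk (continuous_coe_real_ereal.comp (by fun_prop))
  have hbound : ∀ y ∈ D, b - ‖xs‖ * (‖x₀‖ + r) ≤ (φ y).toReal - xs y := fun y hy => by
    have h1 := hb y hy.1
    rw [hreal y hy, EReal.coe_le_coe_iff] at h1
    have h2 := (le_abs_self _).trans (xs.le_opNorm y)
    have h3 := mem_closedBall_iff_norm.1 hy.1
    have h4 : ‖y‖ ≤ ‖x₀‖ + r := by
      have := norm_add_le x₀ (y - x₀)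
      rw [add_sub_cancel] at this
      linarith
    have h5 := mul_le_mul_of_nonneg_left h4 (norm_nonneg xs)
    linarith
  have hρ : ∀ y ∈ D, ‖y - x‖ ≤ 2 * r := fun y hy => by
    have h1 := mem_closedBall_iff_norm.1 hy.1
    have h2 := mem_closedBall_iff_norm'.1 hx
    have := norm_sub_le_norm_sub_add_norm_sub y x₀ x
    linarith
  obtain ⟨y, hyD, p, s, hp, hpy, hs, hmin, hreg⟩ :=
    exists_regular_subgradient hX hclosed ⟨x₀, hx₀D⟩ hbound hρ hδ
  refine ⟨y, hyD.1, hyD.2, p, s, hp, hpy, hs, hmin x₀ hx₀D, fun hyr => ?_⟩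
  refine mem_epsRegularSubdiff_of_eventually hyD.2 (hφb y) fun η hη => ?_
  have htend : Tendsto (fun y' => y' - y) (𝓝 y) (𝓝 0) := by
    have : Continuous fun y' : X => y' - y := by fun_prop
    simpa using this.tendsto y
  filter_upwards [htend.eventually (hreg η hη),
    Metric.isOpen_ball.mem_nhds (mem_ball_iff_norm.2 hyr)] with y' h1 h2
  rcases eq_or_ne (φ y') ⊤ with ht | ht
  · rw [ht]; exact le_top
  have hy'D : y' ∈ D := ⟨Metric.ball_subset_closedBall h2, ht⟩
  rw [add_sub_cancel] at h1
  have h3 := h1 hy'D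
  rw [hreal y hyD, hreal y' hy'D]
  norm_cast
  rw [sub_apply, map_sub xs]
  linarith

/-- Graphical localization: an l.s.c. minorant `g` of `φ`, supporting `φ` at all attentive
subgradients close to `(x₀, xs₀)`, has no further subgradients close to `(x₀, xs₀)`. -/
lemma mem_limitingSubdiff_of_supporting [CompleteSpace X] (hX : IsReflexiveSpace X)
    {φ g : X → EReal} (hφb : NeverBot φ) (hφ : LowerSemicontinuous φ) {x₀ : X}
    {xs₀ : StrongDual ℝ X} (hx₀ : φ x₀ ≠ ⊤) (hgb : NeverBot g) {r ε : ℝ} (hr : 0 < r)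
    (hr1 : r ≤ 1) (hrε : (‖xs₀‖ + 3) * r < ε)
    (hle : ∀ x ∈ Metric.closedBall x₀ r, g x ≤ φ x)
    (hsub₀ : ∀ x, φ x₀ + ((xs₀ (x - x₀) : ℝ) : EReal) ≤ g x)
    (hsub : ∀ y us, ‖y - x₀‖ < r → ‖us - xs₀‖ < r → φ y < φ x₀ + (ε : EReal) →
      us ∈ limitingSubdiff φ y → ∀ x, φ y + ((us (x - y) : ℝ) : EReal) ≤ g x)
    {x : X} {xs : StrongDual ℝ X} (hx : ‖x - x₀‖ < r / 200) (hxs : ‖xs - xs₀‖ < r / 200)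
    (hgx : g x ≠ ⊤) (hgsub : ∀ y, g x + ((xs (y - x) : ℝ) : EReal) ≤ g y) :
    φ x = g x ∧ φ x < φ x₀ + (ε : EReal) ∧ xs ∈ limitingSubdiff φ x := by
  obtain ⟨c, hc⟩ := exists_coe_eq hgx (hgb x)
  obtain ⟨a, ha⟩ := exists_coe_eq hx₀ (hφb x₀)
  have hxB : x ∈ Metric.closedBall x₀ r := mem_closedBall_iff_norm.2 (by linarith)
  have hxs' : ‖xs‖ ≤ ‖xs₀‖ + 1 := by
    have := norm_add_le xs₀ (xs - xs₀)
    rw [add_sub_cancel] at this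
    linarith
  have hlow : ∀ y ∈ Metric.closedBall x₀ r, ((a - ‖xs₀‖ * r : ℝ) : EReal) ≤ φ y := fun y hy => by
    refine le_trans ?_ ((hsub₀ y).trans (hle y hy))
    rw [ha, ← EReal.coe_add, EReal.coe_le_coe_iff]
    have h1 := (abs_le.1 (xs₀.le_opNorm (y - x₀))).1
    have h2 := mul_le_mul_of_nonneg_left (mem_closedBall_iff_norm.1 hy) (norm_nonneg xs₀)
    linarith
  have key : ∀ δ > 0, δ ≤ r ^ 2 / 200 → ∃ y us, us ∈ epsRegularSubdiff 0 φ y ∧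
      ‖y - x‖ ≤ 4 * δ ∧ ‖us - xs‖ ≤ 9 * δ ∧ φ y ≤ ((c + us (y - x) : ℝ) : EReal) := by
    intro δ hδ hδr
    obtain ⟨y, hyB, hyt, p, s, hp, hpy, hs, hmin, hreg⟩ :=
      exists_regular_subgradient_near hX hφb hφ hr hlow hx₀ hxB xs hδ
    obtain ⟨d, hd⟩ := exists_coe_eq hyt (hφb y)
    rw [hd, ha, EReal.toReal_coe, EReal.toReal_coe] at hmin
    have hyr := mem_closedBall_iff_norm.1 hyB
    have h1 := (hsub₀ y).trans (hle y hyB)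
    rw [ha, hd, ← EReal.coe_add, EReal.coe_le_coe_iff, map_sub] at h1
    have h2 : xs (y - x₀) - xs₀ (y - x₀) ≤ r / 200 * r := by
      have h3 := (le_abs_self _).trans ((xs - xs₀).le_opNorm (y - x₀))
      rw [sub_apply] at h3
      refine h3.trans (mul_le_mul hxs.le hyr (norm_nonneg _) (by positivity))
    rw [map_sub, map_sub] at h2
    have h3 : ‖x₀ - x‖ ^ 2 ≤ (r / 200) ^ 2 := by
      rw [norm_sub_rev]
      exact pow_le_pow_left₀ (norm_nonneg _) hx.le 2
    -- Comparing the minimality estimate at `x₀` with the support inequality there gives `‖y - x‖ ^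
    -- 2 / 4 ≤ r ^ 2 / 200 + (r / 200) ^ 2 / 2 + δ`. The radius `r / 4` keeps `y` interior to the
    -- ball and, as `‖p‖ ≤ 2 * ‖y - x‖`, keeps `us` within `r` of `xs₀`.
    have hyx : ‖y - x‖ ≤ r / 4 := by
      refine le_of_sq_le_sq ?_ (by positivity)
      nlinarith [sq_nonneg r]
    have hyx₀ : ‖y - x₀‖ < r := by
      have := norm_sub_le_norm_sub_add_norm_sub y x x₀
      linarith
    have hmem := hreg hyx₀
    set us := xs - (p + s) with hus
    have hps : ‖us - xs‖ ≤ ‖p‖ + ‖s‖ := by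
      have : us - xs = -(p + s) := by rw [hus]; abel
      rw [this, norm_neg]
      exact norm_add_le p s
    have hr2 : r ^ 2 ≤ r := by nlinarith
    have hus₀ : ‖us - xs₀‖ < r := by
      have := norm_sub_le_norm_sub_add_norm_sub us xs xs₀
      linarith
    have hatt : φ y < φ x₀ + (ε : EReal) := by
      rw [ha, hd, ← EReal.coe_add, EReal.coe_lt_coe_iff]
      have h4 := (le_abs_self _).trans (xs.le_opNorm (y - x₀))
      rw [map_sub] at h4
      have h5 : ‖xs‖ * ‖y - x₀‖ ≤ (‖xs₀‖ + 1) * r :=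
        mul_le_mul hxs' hyr (norm_nonneg _) (by positivity)
      nlinarith [sq_nonneg ‖y - x‖]
    have hmono := hsub y us hyx₀ hus₀ hatt (epsRegularSubdiff_subset_limitingSubdiff φ y hmem)
    have h4 := hmono x
    have h5 := (hgsub y).trans (hle y hyB)
    rw [hc, hd, ← EReal.coe_add, EReal.coe_le_coe_iff] at h4 h5
    have h6 : us (x - y) = -us (y - x) := by rw [← map_neg, neg_sub]
    rw [h6] at h4
    have h7 : us (y - x) = xs (y - x) - p (y - x) - s (y - x) := by
      rw [hus, sub_apply, add_apply]; ring
    have h8 := (abs_le.1 (s.le_opNorm (y - x))).1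
    have h9 := mul_le_mul_of_nonneg_right hs (norm_nonneg (y - x))
    -- Adding `h4` and `h5` gives `p (y - x) ≤ -s (y - x) ≤ δ * ‖y - x‖`, against the lower bound
    -- `‖y - x‖ ^ 2 / 4`.
    have hyδ : ‖y - x‖ ≤ 4 * δ := by
      by_contra! hcon
      nlinarith [norm_nonneg (y - x)]
    refine ⟨y, us, hmem, hyδ, by linarith, ?_⟩
    rw [hd, EReal.coe_le_coe_iff]
    linarith
  set δ : ℕ → ℝ := fun k => r ^ 2 / 200 * (1 / ((k : ℝ) + 1)) with hδdef
  have hδ0 : ∀ k, 0 < δ k := fun k => by positivity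
  have hδr : ∀ k, δ k ≤ r ^ 2 / 200 := fun k => by
    refine mul_le_of_le_one_right (by positivity) ?_
    rw [div_le_one (by positivity)]
    linarith [(Nat.cast_nonneg k : (0 : ℝ) ≤ k)]
  have hδlim : Tendsto δ atTop (𝓝 0) := by
    simpa [hδdef] using (tendsto_one_div_add_atTop_nhds_zero_nat (𝕜 := ℝ)).const_mul (r ^ 2 / 200)
  choose y us hmem hyx hus hval using fun k => key (δ k) (hδ0 k) (hδr k)
  have hylim : Tendsto y atTop (𝓝 x) := by
    rw [tendsto_iff_norm_sub_tendsto_zero]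
    exact squeeze_zero (fun _ => norm_nonneg _) hyx (by simpa using hδlim.const_mul 4)
  have huslim : Tendsto us atTop (𝓝 xs) := by
    rw [tendsto_iff_norm_sub_tendsto_zero]
    exact squeeze_zero (fun _ => norm_nonneg _) hus (by simpa using hδlim.const_mul 9)
  have happ : ∀ {v : ℕ → X} {v₀ : X}, Tendsto v atTop (𝓝 v₀) →
      Tendsto (fun k => us k (v k)) atTop (𝓝 (xs v₀)) := fun {v v₀} hv =>
    ((isBoundedBilinearMap_apply (𝕜 := ℝ) (E := X) (F := ℝ)).continuous.tendsto (xs, v₀)).comp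
      (huslim.prodMk_nhds hv)
  have hclim : Tendsto (fun k => ((c + us k (y k - x) : ℝ) : EReal)) atTop (𝓝 (c : EReal)) := by
    rw [EReal.tendsto_coe]
    have h1 : Tendsto (fun k => us k (y k - x)) atTop (𝓝 (xs (x - x))) :=
      happ (hylim.sub_const x)
    simpa using h1.const_add c
  have hφc : φ x ≤ c := le_of_forall_lt fun c' hc' => by
    obtain ⟨c'', h1, h2⟩ := exists_between hc'
    refine h1.trans_le (ge_of_tendsto hclim ?_)
    filter_upwards [hylim.eventually (hφ x c'' h2)] with k hk
    exact hk.le.trans (hval k)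
  have hφx : φ x = c := le_antisymm hφc (hc ▸ hle x hxB)
  refine ⟨hφx.trans hc.symm, ?_, ?_⟩
  · have h1 := (hgsub x₀).trans (hle x₀ (Metric.mem_closedBall_self hr.le))
    rw [hc, ha, ← EReal.coe_add, EReal.coe_le_coe_iff] at h1
    rw [hφx, ha, ← EReal.coe_add, EReal.coe_lt_coe_iff]
    have h2 := (abs_le.1 (xs.le_opNorm (x₀ - x))).1
    rw [norm_sub_rev] at h2
    have h3 : ‖xs‖ * ‖x - x₀‖ ≤ (‖xs₀‖ + 1) * r :=
      mul_le_mul hxs' (by linarith) (norm_nonneg _) (by positivity)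
    linarith
  · refine mem_limitingSubdiff_of_tendsto (hφx ▸ EReal.coe_ne_top c) hylim ?_
      (fun v => happ tendsto_const_nhds) hmem
    refine tendsto_order.2 ⟨fun c' hc' => hylim.eventually (hφ x c' hc'), fun c' hc' => ?_⟩
    rw [hφx] at hc'
    filter_upwards [hclim.eventually (gt_mem_nhds hc')] with k hk
    exact (hval k).trans_lt hk

/-- The minorant is the supremum of the quadratics in (ii), extended to all of `X`. Shrinking the
neighborhoods to radius `r / 200` leaves room for the perturbed pairs used in the localization. -/
theorem HasSubgradientInequalities.isVariationallyConvex [CompleteSpace X]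
    (hX : IsReflexiveSpace X) {σ : ℝ} (hσ : 0 ≤ σ) {φ : X → EReal} (hφb : NeverBot φ)
    (hφ : LowerSemicontinuous φ) {x₀ : X} {xs₀ : StrongDual ℝ X}
    (hxs₀ : xs₀ ∈ limitingSubdiff φ x₀) (h : HasSubgradientInequalities σ φ x₀ xs₀) :
    IsVariationallyConvex σ φ x₀ xs₀ := by
  obtain ⟨U, V, ε, ⟨hUo, hUc, hxU, hVo, hVc, hxV⟩, hε, hineq⟩ := h
  set T := (attentive φ x₀ U ε ×ˢ V) ∩ gphSubdiff φ
  choose j hj hjx using fun z : T => hineq z.1.1 z.1.2 z.2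
  have hxt : φ x₀ ≠ ⊤ := hxs₀.1
  have hatt₀ : φ x₀ < φ x₀ + (ε : EReal) := by
    obtain ⟨a, ha⟩ := exists_coe_eq hxt (hφb x₀)
    rw [ha, ← EReal.coe_add, EReal.coe_lt_coe_iff]
    linarith
  have hT₀ : (x₀, xs₀) ∈ T := ⟨⟨⟨hxU, hatt₀⟩, hxV⟩, hxs₀⟩
  have : Nonempty T := ⟨⟨_, hT₀⟩⟩
  have hreal : ∀ z : T, φ z.1.1 = ((φ z.1.1).toReal : EReal) := fun z =>
    (EReal.coe_toReal z.2.2.1 (hφb _)).symm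
  set α : T → ℝ := fun z => (φ z.1.1).toReal - z.1.2 z.1.1 + σ / 2 * ‖z.1.1‖ ^ 2 with hα
  -- Expanding the right-hand side of (ii) gives an affine function plus `σ / 2 * ‖x‖ ^ 2`; the
  -- common quadratic term makes the supremum `σ`-strongly convex.
  set l : T → StrongDual ℝ X := fun z => z.1.2 - σ • j z with hl
  set g : X → EReal := fun x => ⨆ z : T, ((α z + l z x + σ / 2 * ‖x‖ ^ 2 : ℝ) : EReal)
  have hg' : ∀ x, g x = ⨆ z : T, ((α z + l z x + σ / 2 * ‖x‖ ^ 2 : ℝ) : EReal) := fun x => rfl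
  have hterm : ∀ z : T, ∀ x, φ z.1.1 + ((z.1.2 (x - z.1.1) +
      σ / 2 * (‖z.1.1‖ ^ 2 - 2 * j z x + ‖x‖ ^ 2) : ℝ) : EReal) =
        ((α z + l z x + σ / 2 * ‖x‖ ^ 2 : ℝ) : EReal) := fun z x => by
    rw [hreal z, ← EReal.coe_add]
    simp only [hα, hl, sub_apply, smul_apply, smul_eq_mul, map_sub]
    congr 1
    ring
  have hgU : ∀ x ∈ U, g x ≤ φ x := fun x hx => iSup_le fun z => by
    rw [← hterm]
    exact hjx z x hx
  have hsupp : ∀ z ∈ T, ∀ x, φ z.1 + ((z.2 (x - z.1) : ℝ) : EReal) ≤ g x := fun z hz x => by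
    refine le_trans ?_ (le_iSup (fun z : T => ((α z + l z x + σ / 2 * ‖x‖ ^ 2 : ℝ) : EReal))
      ⟨z, hz⟩)
    rw [← hterm]
    gcongr
    have := mul_nonneg (show (0 : ℝ) ≤ σ / 2 by positivity)
      (quadratic_nonneg (x := x) (hj ⟨z, hz⟩))
    simp only at this ⊢
    linarith
  have hgT : ∀ z ∈ T, g z.1 = φ z.1 := fun z hz =>
    le_antisymm (hgU _ hz.1.1.1) (by simpa using hsupp z hz z.1)
  have hgb : NeverBot g := neverBot_of_iSup hg'
  have hgc : IsConvex g := isConvex_of_iSup hσ hg'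
  obtain ⟨r₁, hr₁, hr₁U⟩ := Metric.nhds_basis_closedBall.mem_iff.1 (hUo.mem_nhds hxU)
  obtain ⟨r₂, hr₂, hr₂V⟩ := Metric.isOpen_iff.1 hVo xs₀ hxV
  obtain ⟨r, hr, hrr₁, hrr₂, hr1, hrε⟩ : ∃ r > 0, r ≤ r₁ ∧ r ≤ r₂ ∧ r ≤ 1 ∧
      (‖xs₀‖ + 3) * r < ε := by
    have hpos : 0 < ‖xs₀‖ + 4 := by positivity
    refine ⟨min (min r₁ r₂) (min 1 (ε / (‖xs₀‖ + 4))), by positivity,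
      (min_le_left _ _).trans (min_le_left _ _), (min_le_left _ _).trans (min_le_right _ _),
      (min_le_right _ _).trans (min_le_left _ _), ?_⟩
    have h1 : min (min r₁ r₂) (min 1 (ε / (‖xs₀‖ + 4))) ≤ ε / (‖xs₀‖ + 4) :=
      (min_le_right _ _).trans (min_le_right _ _)
    refine (mul_le_mul_of_nonneg_left h1 (by positivity)).trans_lt ?_
    rw [mul_div_assoc', div_lt_iff₀ hpos]
    nlinarith
  have hball : Metric.closedBall x₀ r ⊆ U := (Metric.closedBall_subset_closedBall hrr₁).trans hr₁U
  have hrV : ∀ us : StrongDual ℝ X, ‖us - xs₀‖ < r → us ∈ V := fun us hus =>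
    hr₂V (mem_ball_iff_norm.2 (hus.trans_le hrr₂))
  have hloc : ∀ z ∈ (Metric.ball x₀ (r / 200) ×ˢ Metric.ball xs₀ (r / 200)) ∩ gphSubdiff g,
      φ z.1 = g z.1 ∧ φ z.1 < φ x₀ + (ε : EReal) ∧ z.2 ∈ limitingSubdiff φ z.1 := by
    rintro ⟨x, xs⟩ ⟨⟨hx, hxs⟩, hmem⟩
    exact mem_limitingSubdiff_of_supporting hX hφb hφ hxt hgb hr hr1 hrε
      (fun y hy => hgU y (hball hy)) (hsupp _ hT₀)
      (fun y us hy hus hyε hyus => hsupp (y, us)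
        ⟨⟨⟨hball (mem_closedBall_iff_norm.2 hy.le), hyε⟩, hrV us hus⟩, hyus⟩)
      (mem_ball_iff_norm.1 hx) (mem_ball_iff_norm.1 hxs) hmem.1
      (hgc.le_of_mem_limitingSubdiff hgb hmem)
  have hr' : 0 < r / 200 := by positivity
  have hsmall : Metric.ball x₀ (r / 200) ⊆ U := fun y hy =>
    hball (mem_closedBall_iff_norm.2 (by linarith [mem_ball_iff_norm.1 hy]))
  refine ⟨hxs₀, Metric.ball x₀ (r / 200), Metric.ball xs₀ (r / 200), g, ε,
    ⟨Metric.isOpen_ball, convex_ball _ _, Metric.mem_ball_self hr', Metric.isOpen_ball,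
      convex_ball _ _, Metric.mem_ball_self hr'⟩, hε, hgb, lowerSemicontinuous_of_iSup hg', hgc,
    fun _ => isStronglyConvex_of_iSup hg', fun x hx => hgU x (hsmall hx), ?_,
    fun z hz => (hloc z hz).1⟩
  ext z
  constructor
  · rintro ⟨⟨⟨hz1, hz2⟩, hz3⟩, hz4⟩
    have hzT : z ∈ T :=
      ⟨⟨⟨hsmall hz1, hz2⟩, hrV z.2 (by linarith [mem_ball_iff_norm.1 hz3])⟩, hz4⟩
    refine ⟨⟨hz1, hz3⟩, mem_limitingSubdiff_of_le ?_ (hgb _) fun y => ?_⟩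
    · rw [hgT z hzT]; exact hz4.1
    · rw [hgT z hzT]; exact hsupp z hzT y
  · intro hz
    exact ⟨⟨⟨hz.1.1, (hloc z hz).2.1⟩, hz.1.2⟩, (hloc z hz).2.2⟩

end VarConvex

theorem theorem5p5 {X : Type*} [NormedAddCommGroup X] [NormedSpace ℝ X] [CompleteSpace X]
    (φ : X → EReal) (hφ_bot : VarConvex.NeverBot φ) (hφ_lsc : LowerSemicontinuous φ)
    (x₀ : X) (xs₀ : StrongDual ℝ X) (hxs₀ : xs₀ ∈ VarConvex.limitingSubdiff φ x₀)
    (σ : ℝ) (hσ : 0 ≤ σ) :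
    (VarConvex.IsVariationallyConvex σ φ x₀ xs₀ →
      VarConvex.HasSubgradientInequalities σ φ x₀ xs₀) ∧
    (VarConvex.IsReflexiveSpace X → VarConvex.WeakSeqLSCAround φ x₀ →
      VarConvex.HasSubgradientInequalities σ φ x₀ xs₀ →
      VarConvex.IsVariationallyConvex σ φ x₀ xs₀) :=
  ⟨fun h => h.hasSubgradientInequalities hσ,
    fun hX _ h => h.isVariationallyConvex hX hσ hφ_bot hφ_lsc hxs₀⟩
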